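/- Let $f:\mathbf R\to\mathbf R$ be a locally integrable function, not equal to $0$ almost everywhere, such that $\int_{\mathbf R}|f(x)|e^{-\lambda|x|}\,dx<\infty$ for every $\lambda>0$. Put $F^+(z)=\int_{-\infty}^0 f(t)e^{-itz}\,dt$ for $\operatorname{Im}z>0$ and $F^-(z)=-\int_0^\infty f(t)e^{-itz}\,dt$ for $\operatorname{Im}z<0$. Let $a>0$, and assume: (1) $f$ has bounded spectrum: for some $b\ge 0$ there is a function analytic on $\overline{\mathbf C}\setminus[-b,b]$ (including the point $\infty$) that coincides with $F^+$ in the upper half-plane and with $F^-$ in the lower half-plane; (2) $f$ has the spectral gap $(-a,a)$: $F^+$ and $F^-$ are analytic continuations of each other through the interval $(-a,a)$. For $t\geq 0$ let $s(t,f)$ and $s(-t,f)$ be the numbers of sign changes of $f$ on $[0,t]$ and on $[-t,0]$, respectively; sign changes of $f$ on an interval are understood up to sets of measure zero, that is, their number is the supremum of the $n$ for which the interval contains points $x_0<\dots<x_n$ and there is a sign $\varepsilon=\pm1$ such that, for every $i$, the set of those points $y$ of the interval with $(-1)^i\varepsilon f(y)>0$ has positive measure in every neighbourhood of $x_i$.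 Let $$S(r,f)=\int_0^r\frac{s(t,f)+s(-t,f)}{t}\,dt .$$ Then $S(r,f)$ is finite for every $r>0$, and $$\liminf_{r\to\infty}\frac{S(r,f)}{r}\ \ge\ \frac{2a}{\pi}.$$ -/

import Mathlib

open scoped ENNReal

noncomputable section

/-- `f` is locally integrable and `∫ |f(x)| e^{-l|x|} dx < ∞` for all `l > 0`: the class of
functions for which the generalized (Carleman) Fourier transform is defined. -/
def CarlemanClass (f : ℝ → ℝ) : Prop :=
  MeasureTheory.LocallyIntegrable f MeasureTheory.volume ∧
    ∀ l : ℝ, 0 < l →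
      MeasureTheory.Integrable (fun x : ℝ => |f x| * Real.exp (-l * |x|)) MeasureTheory.volume

/-- `F⁺(z) = ∫_{-∞}^0 f(t) e^{-itz} dt`, used for `Im z > 0`. -/
def carlemanPlus (f : ℝ → ℝ) (z : ℂ) : ℂ :=
  ∫ t in Set.Iic (0 : ℝ), (f t : ℂ) * Complex.exp (-Complex.I * t * z)

/-- `F⁻(z) = -∫_0^∞ f(t) e^{-itz} dt`, used for `Im z < 0`. -/
def carlemanMinus (f : ℝ → ℝ) (z : ℂ) : ℂ :=
  -∫ t in Set.Ici (0 : ℝ), (f t : ℂ) * Complex.exp (-Complex.I * t * z)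

/-- `F` coincides with `F⁺` in the open upper half-plane and with `F⁻` in the open lower one. -/
def ExtendsCarleman (f : ℝ → ℝ) (F : ℂ → ℂ) : Prop :=
  (∀ z : ℂ, 0 < z.im → F z = carlemanPlus f z) ∧
    (∀ z : ℂ, z.im < 0 → F z = carlemanMinus f z)

/-- `f` has the spectral gap `(-a, a)`: `F⁺` and `F⁻` are analytic continuations of each other
through the real interval `(-a, a)`. -/
def HasSpectralGap (f : ℝ → ℝ) (a : ℝ) : Prop :=
  ∃ F : ℂ → ℂ, ExtendsCarleman f F ∧
    AnalyticOnNhd ℂ F ({z : ℂ | z.im ≠ 0} ∪ Complex.ofReal '' Set.Ioo (-a) a)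

/-- `F` is analytic at the point `∞` of the Riemann sphere. -/
def AnalyticAtInfty (F : ℂ → ℂ) : Prop :=
  ∃ G : ℂ → ℂ, AnalyticAt ℂ G 0 ∧ ∀ᶠ w in nhdsWithin (0 : ℂ) {0}ᶜ, G w = F w⁻¹

/-- `f` has bounded spectrum: the pair `(F⁺, F⁻)` extends to a function analytic on the Riemann
sphere (including `∞`) outside some segment `[-b, b]` of the real axis. -/
def HasBoundedSpectrum (f : ℝ → ℝ) : Prop :=
  ∃ b : ℝ, 0 ≤ b ∧ ∃ F : ℂ → ℂ, ExtendsCarleman f F ∧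
    AnalyticOnNhd ℂ F (Complex.ofReal '' Set.Icc (-b) b)ᶜ ∧ AnalyticAtInfty F

/-- `f` changes sign at least `n` times on `J`: there are points `x 0 < ⋯ < x n` of `J` such that
`ε f, -ε f, ε f, …` (for a sign `ε`) is positive on a subset of `J` of positive measure in every
neighbourhood of `x 0, x 1, x 2, …`, respectively. The notion depends only on the class of `f`
modulo equality almost everywhere; for continuous `f` and a nondegenerate interval `J` it says
that `f` takes values of strictly alternating signs at some `n + 1` successive points of `J`. -/
def ChangesSign (f : ℝ → ℝ) (J : Set ℝ) (n : ℕ) : Prop :=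
  ∃ ε : ℝ, (ε = 1 ∨ ε = -1) ∧ ∃ x : Fin (n + 1) → ℝ, StrictMono x ∧ ∀ i, x i ∈ J ∧
    ∀ δ : ℝ, 0 < δ →
      0 < MeasureTheory.volume {y : ℝ | y ∈ J ∧ |y - x i| < δ ∧ 0 < ε * (-1) ^ (i : ℕ) * f y}

/-- `s(t, f)`: the number of sign changes of `f` on the closed interval with endpoints `0` and `t`
(so on `[0, t]` for `t ≥ 0` and on `[t, 0]` for `t ≤ 0`), possibly infinite. -/
def signChanges (f : ℝ → ℝ) (t : ℝ) : ℕ∞ :=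
  ⨆ n : {n : ℕ // ChangesSign f (Set.uIcc 0 t) n}, ((n : ℕ) : ℕ∞)

/-- `S(r, f) = ∫_0^r (s(t, f) + s(-t, f)) / t dt`, with values in `[0, ∞]`. -/
def averagedSignChanges (f : ℝ → ℝ) (r : ℝ) : ℝ≥0∞ :=
  ∫⁻ t in Set.Ioc (0 : ℝ) r,
    ((signChanges f t : ℝ≥0∞) + (signChanges f (-t) : ℝ≥0∞)) / ENNReal.ofReal t

end

open Complex Set MeasureTheory Filter Topology
open scoped ComplexConjugate Interval FourierTransform ContDiff

noncomputable section

/-! The spectral gap makes `f` the real part on the real line of an entire function `h` that decays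
like `exp (-α Im z)` in the upper half-plane; Jensen's formula turns this decay into rotation of `h`
along the real axis, and every half-turn of `h` forces its real part to change sign.

To build `h`, the two Carleman transforms are glued into one function `F` vanishing at infinity
(`exists_carleman_extension`). Cauchy's formula outside a slit (`rectIntegral_div_sub`) and
uniqueness of Laplace transforms (`LaplacePair.ae_eq_zero`) represent `f` as the integral of `F ζ *
exp (i t ζ)` over the boundary of a thin rectangle around the spectrum. The part of the rectangle
inside the gap contributes nothing, so the contour splits into a positive-frequency and a
negative-frequency piece. Reflecting the second one gives `h` (`exists_entire_of_spectralGap`), at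
the price of a factor `exp (δ |Re z|)`.

A small imaginary constant removes the zeros of `h` on `[-r, r]` and keeps the real part. With `φ` a
continuous phase there, a Jensen inequality in the half disc (`phaseJensen_of_real_ne_zero`) bounds
the integral of `(φ t - φ (-t)) / t` below by the decrease of the half-circle integral of `log |h|`,
which is at least about `(2α - πδ) r`. A phase change `Δ` costs at least `Δ / π - 1` sign changes
(`ofReal_phase_le_signChanges`), and the lost units integrate only to a logarithm. Dividing by `r`
and letting `α → a`, `δ → 0` gives the constant. Finiteness holds because the real part of `h` has
finitely many zeros on bounded intervals. -/

/-! ### Contour integrals over rectangles and Cauchy's formula outside a slit. -/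

/-- The integral of `H` over the positively oriented boundary of `[x₁, x₂] × [y₁, y₂]`. -/
def rectIntegral (H : ℂ → ℂ) (x₁ x₂ y₁ y₂ : ℝ) : ℂ :=
  (∫ x in x₁..x₂, H (x + y₁ * I)) - (∫ x in x₁..x₂, H (x + y₂ * I)) +
    I * (∫ y in y₁..y₂, H (x₂ + y * I)) - I * ∫ y in y₁..y₂, H (x₁ + y * I)

lemma rectIntegral_eq_zero {H : ℂ → ℂ} {x₁ x₂ y₁ y₂ : ℝ}
    (hH : DifferentiableOn ℂ H ([[x₁, x₂]] ×ℂ [[y₁, y₂]])) :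
    rectIntegral H x₁ x₂ y₁ y₂ = 0 := by
  have := Complex.integral_boundary_rect_eq_zero_of_differentiableOn H ⟨x₁, y₁⟩ ⟨x₂, y₂⟩ hH
  simpa [rectIntegral] using this

lemma continuousOn_horizontal {H : ℂ → ℂ} {S : Set ℂ} (hH : ContinuousOn H S) {x₁ x₂ y : ℝ}
    (hS : ∀ x ∈ [[x₁, x₂]], (x + y * I : ℂ) ∈ S) :
    ContinuousOn (fun x : ℝ => H (x + y * I)) [[x₁, x₂]] :=
  hH.comp (by fun_prop) hS

lemma continuousOn_vertical {H : ℂ → ℂ} {S : Set ℂ} (hH : ContinuousOn H S) {x y₁ y₂ : ℝ}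
    (hS : ∀ y ∈ [[y₁, y₂]], (x + y * I : ℂ) ∈ S) :
    ContinuousOn (fun y : ℝ => H (x + y * I)) [[y₁, y₂]] :=
  hH.comp (by fun_prop) hS

lemma rectIntegral_add {H : ℂ → ℂ} {S : Set ℂ} (hH : ContinuousOn H S) {x₁ x₂ x₃ y₁ y₂ : ℝ}
    (h1 : ∀ x ∈ [[x₁, x₂]], (x + y₁ * I : ℂ) ∈ S ∧ (x + y₂ * I : ℂ) ∈ S)
    (h2 : ∀ x ∈ [[x₂, x₃]], (x + y₁ * I : ℂ) ∈ S ∧ (x + y₂ * I : ℂ) ∈ S) :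
    rectIntegral H x₁ x₃ y₁ y₂ = rectIntegral H x₁ x₂ y₁ y₂ + rectIntegral H x₂ x₃ y₁ y₂ := by
  have e1 := intervalIntegral.integral_add_adjacent_intervals
    (continuousOn_horizontal hH fun x hx => (h1 x hx).1).intervalIntegrable (μ := volume)
    (continuousOn_horizontal hH fun x hx => (h2 x hx).1).intervalIntegrable
  have e2 := intervalIntegral.integral_add_adjacent_intervals
    (continuousOn_horizontal hH fun x hx => (h1 x hx).2).intervalIntegrable (μ := volume)
    (continuousOn_horizontal hH fun x hx => (h2 x hx).2).intervalIntegrable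
  unfold rectIntegral
  linear_combination -e1 + e2

lemma rectIntegral_add_vertical {H : ℂ → ℂ} {S : Set ℂ} (hH : ContinuousOn H S)
    {x₁ x₂ y₁ y₂ y₃ : ℝ}
    (h1 : ∀ y ∈ [[y₁, y₂]], (x₁ + y * I : ℂ) ∈ S ∧ (x₂ + y * I : ℂ) ∈ S)
    (h2 : ∀ y ∈ [[y₂, y₃]], (x₁ + y * I : ℂ) ∈ S ∧ (x₂ + y * I : ℂ) ∈ S) :
    rectIntegral H x₁ x₂ y₁ y₃ = rectIntegral H x₁ x₂ y₁ y₂ + rectIntegral H x₁ x₂ y₂ y₃ := by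
  have e1 := intervalIntegral.integral_add_adjacent_intervals
    (continuousOn_vertical hH fun y hy => (h1 y hy).1).intervalIntegrable (μ := volume)
    (continuousOn_vertical hH fun y hy => (h2 y hy).1).intervalIntegrable
  have e2 := intervalIntegral.integral_add_adjacent_intervals
    (continuousOn_vertical hH fun y hy => (h1 y hy).2).intervalIntegrable (μ := volume)
    (continuousOn_vertical hH fun y hy => (h2 y hy).2).intervalIntegrable
  unfold rectIntegral
  linear_combination I * e1 - I * e2

lemma rectIntegral_linear {H K : ℂ → ℂ} {S : Set ℂ} (hH : ContinuousOn H S)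
    (hK : ContinuousOn K S) (c : ℂ) {x₁ x₂ y₁ y₂ : ℝ}
    (hx : ∀ x ∈ [[x₁, x₂]], (x + y₁ * I : ℂ) ∈ S ∧ (x + y₂ * I : ℂ) ∈ S)
    (hy : ∀ y ∈ [[y₁, y₂]], (x₁ + y * I : ℂ) ∈ S ∧ (x₂ + y * I : ℂ) ∈ S) :
    rectIntegral (fun ζ => H ζ + c * K ζ) x₁ x₂ y₁ y₂ =
      rectIntegral H x₁ x₂ y₁ y₂ + c * rectIntegral K x₁ x₂ y₁ y₂ := by
  unfold rectIntegral
  rw [intervalIntegral.integral_add, intervalIntegral.integral_add, intervalIntegral.integral_add,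
    intervalIntegral.integral_add]
  · simp only [intervalIntegral.integral_const_mul]
    ring
  · exact (continuousOn_vertical hH fun y h => (hy y h).1).intervalIntegrable
  · exact ((continuousOn_vertical hK fun y h => (hy y h).1).intervalIntegrable).const_mul c
  · exact (continuousOn_vertical hH fun y h => (hy y h).2).intervalIntegrable
  · exact ((continuousOn_vertical hK fun y h => (hy y h).2).intervalIntegrable).const_mul c
  · exact (continuousOn_horizontal hH fun x h => (hx x h).2).intervalIntegrable
  · exact ((continuousOn_horizontal hK fun x h => (hx x h).2).intervalIntegrable).const_mul c
  · exact (continuousOn_horizontal hH fun x h => (hx x h).1).intervalIntegrable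
  · exact ((continuousOn_horizontal hK fun x h => (hx x h).1).intervalIntegrable).const_mul c

/-- The plane slit along `[-M, M]`. -/
def slitCompl (M : ℝ) : Set ℂ := (Complex.ofReal '' Icc (-M) M)ᶜ

lemma mem_slitCompl {M : ℝ} {z : ℂ} : z ∈ slitCompl M ↔ z.im ≠ 0 ∨ M < |z.re| := by
  constructor
  · intro h
    by_contra! hc
    exact h ⟨z.re, abs_le.1 hc.2, Complex.ext rfl (by simp [hc.1])⟩
  · rintro h ⟨x, hx, rfl⟩
    rcases h with h | h
    · simp at h
    · exact absurd (abs_le.2 hx) (by simpa using h)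

lemma isOpen_slitCompl (M : ℝ) : IsOpen (slitCompl M) :=
  ((isCompact_Icc.image continuous_ofReal).isClosed).isOpen_compl

/-- The frame between the two contours is cut into four rectangles (below, above, left, right), each
avoiding the slit, so Cauchy's theorem kills each of them. -/
lemma rectIntegral_frame {q : ℂ → ℂ} {M R N δ : ℝ} (hq : DifferentiableOn ℂ q (slitCompl M))
    (hMR : M < R) (hR : 0 < R) (hRN : R ≤ N) (hδ : 0 < δ) (hδN : δ ≤ N) :
    rectIntegral q (-N) N (-N) N = rectIntegral q (-R) R (-δ) δ := by
  have hc := hq.continuousOn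
  have hN : 0 < N := by linarith
  have key : ∀ x y : ℝ, (y ≠ 0 ∨ R ≤ |x|) → (x + y * I : ℂ) ∈ slitCompl M := by
    intro x y h
    rw [mem_slitCompl]
    rcases h with h | h
    · left; simpa using h
    · right; simpa using hMR.trans_le h
  have kN : ∀ y : ℝ, ((-N : ℝ) + y * I : ℂ) ∈ slitCompl M ∧ ((N : ℝ) + y * I : ℂ) ∈ slitCompl M :=
    fun y => ⟨key _ _ (Or.inr (by rw [abs_neg, abs_of_pos hN]; exact hRN)),
      key _ _ (Or.inr (by rw [abs_of_pos hN]; exact hRN))⟩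
  have kδ : ∀ x : ℝ, (x + (-δ : ℝ) * I : ℂ) ∈ slitCompl M ∧ (x + δ * I : ℂ) ∈ slitCompl M :=
    fun x => ⟨key _ _ (Or.inl (by linarith)), key _ _ (Or.inl hδ.ne')⟩
  have s1 := rectIntegral_add_vertical (y₁ := -N) (y₂ := -δ) (y₃ := N) hc
    (fun y _ => kN y) (fun y _ => kN y)
  have s2 := rectIntegral_add_vertical (y₁ := -δ) (y₂ := δ) (y₃ := N) hc
    (fun y _ => kN y) (fun y _ => kN y)
  have s3 := rectIntegral_add (x₁ := -N) (x₂ := -R) (x₃ := N) hc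
    (fun x _ => kδ x) (fun x _ => kδ x)
  have s4 := rectIntegral_add (x₁ := -R) (x₂ := R) (x₃ := N) hc
    (fun x _ => kδ x) (fun x _ => kδ x)
  have sub : ∀ {A B : Set ℝ}, (∀ x ∈ A, ∀ y ∈ B, y ≠ 0 ∨ R ≤ |x|) →
      DifferentiableOn ℂ q (A ×ℂ B) := by
    intro A B h
    refine hq.mono fun z hz => ?_
    have := key z.re z.im (h _ hz.1 _ hz.2)
    rwa [re_add_im] at this
  have z1 : rectIntegral q (-N) N (-N) (-δ) = 0 := rectIntegral_eq_zero <| sub fun x _ y hy => by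
    rw [uIcc_of_le (by linarith)] at hy
    left; linarith [hy.2]
  have z2 : rectIntegral q (-N) N δ N = 0 := rectIntegral_eq_zero <| sub fun x _ y hy => by
    rw [uIcc_of_le (by linarith)] at hy
    left; linarith [hy.1]
  have z3 : rectIntegral q (-N) (-R) (-δ) δ = 0 := rectIntegral_eq_zero <| sub fun x hx y _ => by
    rw [uIcc_of_le (by linarith)] at hx
    right; rw [abs_of_neg (by linarith [hx.2])]; linarith [hx.2]
  have z4 : rectIntegral q R N (-δ) δ = 0 := rectIntegral_eq_zero <| sub fun x hx y _ => by
    rw [uIcc_of_le (by linarith)] at hx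
    right; exact hx.1.trans (le_abs_self x)
  rw [s1, s2, s3, s4, z1, z2, z3, z4]
  ring

lemma norm_rectIntegral_square_le {H : ℂ → ℂ} {N B : ℝ} (hN : 0 < N)
    (hH : ∀ ζ : ℂ, N ≤ ‖ζ‖ → ‖H ζ‖ ≤ B) :
    ‖rectIntegral H (-N) N (-N) N‖ ≤ 8 * N * B := by
  have k1 : ∀ x : ℝ, N ≤ ‖(x + N * I : ℂ)‖ := fun x => by
    simpa [abs_of_pos hN] using Complex.abs_im_le_norm (x + N * I)
  have k2 : ∀ x : ℝ, N ≤ ‖(x + (-N : ℝ) * I : ℂ)‖ := fun x => by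
    simpa [abs_of_pos hN] using Complex.abs_im_le_norm (x + (-N : ℝ) * I)
  have k3 : ∀ y : ℝ, N ≤ ‖(N + y * I : ℂ)‖ := fun y => by
    simpa [abs_of_pos hN] using Complex.abs_re_le_norm (N + y * I)
  have k4 : ∀ y : ℝ, N ≤ ‖((-N : ℝ) + y * I : ℂ)‖ := fun y => by
    simpa [abs_of_pos hN] using Complex.abs_re_le_norm ((-N : ℝ) + y * I)
  have ab : |N - -N| = 2 * N := by rw [abs_of_pos (by linarith)]; ring
  have b1 := intervalIntegral.norm_integral_le_of_norm_le_const (a := -N) (b := N) fun x _ => hH _ (k1 x)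
  have b2 := intervalIntegral.norm_integral_le_of_norm_le_const (a := -N) (b := N) fun x _ => hH _ (k2 x)
  have b3 := intervalIntegral.norm_integral_le_of_norm_le_const (a := -N) (b := N) fun x _ => hH _ (k3 x)
  have b4 := intervalIntegral.norm_integral_le_of_norm_le_const (a := -N) (b := N) fun x _ => hH _ (k4 x)
  rw [ab] at b1 b2 b3 b4
  unfold rectIntegral
  refine (norm_sub_le _ _).trans ?_
  refine (add_le_add (norm_add_le _ _) le_rfl).trans ?_
  refine (add_le_add (add_le_add (norm_sub_le _ _) le_rfl) le_rfl).trans ?_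
  rw [norm_mul, norm_mul, norm_I, one_mul, one_mul]
  linarith

lemma integral_scaled_cauchy {N : ℝ} (hN : 0 < N) :
    ∫ x in (-N)..N, N / (x ^ 2 + N ^ 2) = Real.pi / 2 := by
  have h := intervalIntegral.integral_comp_div (a := -N) (b := N)
    (fun x : ℝ => (1 + x ^ 2)⁻¹) hN.ne'
  rw [neg_div, div_self hN.ne', integral_inv_one_add_sq, Real.arctan_neg, Real.arctan_one] at h
  have e : ∀ x : ℝ, N / (x ^ 2 + N ^ 2) = N⁻¹ * (1 + (x / N) ^ 2)⁻¹ := by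
    intro x
    have : 0 < x ^ 2 + N ^ 2 := by positivity
    field_simp
    ring
  simp_rw [e]
  rw [intervalIntegral.integral_const_mul, h, smul_eq_mul]
  field_simp
  ring

lemma rectIntegral_inv_square {N : ℝ} (hN : 0 < N) :
    rectIntegral (fun ζ => ζ⁻¹) (-N) N (-N) N = 2 * Real.pi * I := by
  have hS : ContinuousOn (fun ζ : ℂ => ζ⁻¹) {0}ᶜ := continuousOn_inv₀
  have n1 : ∀ x y : ℝ, (x ≠ 0 ∨ y ≠ 0) → (x + y * I : ℂ) ≠ 0 := by
    intro x y h hz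
    have h1 := congrArg Complex.re hz
    have h2 := congrArg Complex.im hz
    simp at h1 h2
    tauto
  have i1 := (continuousOn_horizontal (x₁ := -N) (x₂ := N) (y := -N) hS
    fun x _ => n1 x (-N) (Or.inr (by linarith))).intervalIntegrable (μ := volume)
  have i2 := (continuousOn_horizontal (x₁ := -N) (x₂ := N) (y := N) hS
    fun x _ => n1 x N (Or.inr (by linarith))).intervalIntegrable (μ := volume)
  have i3 := (continuousOn_vertical (y₁ := -N) (y₂ := N) (x := N) hS
    fun y _ => n1 N y (Or.inl (by linarith))).intervalIntegrable (μ := volume)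
  have i4 := (continuousOn_vertical (y₁ := -N) (y₂ := N) (x := -N) hS
    fun y _ => n1 (-N) y (Or.inl (by linarith))).intervalIntegrable (μ := volume)
  have I1 : ((I : ℂ)) ^ 2 = -1 := I_sq
  -- Opposite sides are paired, which turns the integrand into a real Cauchy kernel; each pair
  -- contributes half of `2πi`.
  have a1 : (∫ x in (-N)..N, ((x : ℂ) + ((-N : ℝ) : ℂ) * I)⁻¹) -
      (∫ x in (-N)..N, ((x : ℂ) + (N : ℂ) * I)⁻¹) = Real.pi * I := by
    rw [← intervalIntegral.integral_sub i1 i2]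
    have : ∀ x : ℝ, ((x : ℂ) + ((-N : ℝ) : ℂ) * I)⁻¹ - ((x : ℂ) + (N : ℂ) * I)⁻¹ =
        (2 * I) * ((N / (x ^ 2 + N ^ 2) : ℝ) : ℂ) := by
      intro x
      have h1 := n1 x (-N) (Or.inr (by linarith))
      have h2 := n1 x N (Or.inr (by linarith))
      have h3 : ((x : ℂ) ^ 2 + (N : ℂ) ^ 2) ≠ 0 := by
        have : (x ^ 2 + N ^ 2 : ℝ) ≠ 0 := by positivity
        exact_mod_cast this
      have h4 : ((x : ℂ) ^ 2 + (N : ℂ) ^ 2) =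
          ((x : ℂ) + ((-N : ℝ) : ℂ) * I) * ((x : ℂ) + (N : ℂ) * I) := by
        push_cast; linear_combination ((N : ℂ) ^ 2) * I1
      push_cast
      rw [h4]
      push_cast at h1 ⊢
      rw [neg_mul, ← sub_eq_add_neg] at h1 ⊢
      field_simp
      ring
    simp_rw [this]
    rw [intervalIntegral.integral_const_mul, intervalIntegral.integral_ofReal,
      integral_scaled_cauchy hN]
    push_cast; ring
  have a2 : (∫ y in (-N)..N, ((N : ℂ) + (y : ℂ) * I)⁻¹) -
      (∫ y in (-N)..N, (((-N : ℝ) : ℂ) + (y : ℂ) * I)⁻¹) = Real.pi := by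
    rw [← intervalIntegral.integral_sub i3 i4]
    have : ∀ x : ℝ, ((N : ℂ) + (x : ℂ) * I)⁻¹ - (((-N : ℝ) : ℂ) + (x : ℂ) * I)⁻¹ =
        2 * ((N / (x ^ 2 + N ^ 2) : ℝ) : ℂ) := by
      intro x
      have h1 := n1 (-N) x (Or.inl (by linarith))
      have h2 := n1 N x (Or.inl (by linarith))
      have h4 : ((x : ℂ) ^ 2 + (N : ℂ) ^ 2) =
          -((((-N : ℝ) : ℂ) + (x : ℂ) * I) * ((N : ℂ) + (x : ℂ) * I)) := by
        push_cast; linear_combination ((x : ℂ) ^ 2) * I1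
      push_cast
      rw [h4]
      push_cast at h1 ⊢
      field_simp
      ring
    simp_rw [this]
    rw [intervalIntegral.integral_const_mul, intervalIntegral.integral_ofReal,
      integral_scaled_cauchy hN]
    push_cast; ring
  unfold rectIntegral
  linear_combination a1 + I * a2

lemma rectIntegral_congr {H K : ℂ → ℂ} {x₁ x₂ y₁ y₂ : ℝ}
    (hx : ∀ x ∈ [[x₁, x₂]], H (x + y₁ * I) = K (x + y₁ * I) ∧ H (x + y₂ * I) = K (x + y₂ * I))
    (hy : ∀ y ∈ [[y₁, y₂]], H (x₁ + y * I) = K (x₁ + y * I) ∧ H (x₂ + y * I) = K (x₂ + y * I)) :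
    rectIntegral H x₁ x₂ y₁ y₂ = rectIntegral K x₁ x₂ y₁ y₂ := by
  unfold rectIntegral
  rw [intervalIntegral.integral_congr fun x h => (hx x h).1,
    intervalIntegral.integral_congr fun x h => (hx x h).2,
    intervalIntegral.integral_congr fun y h => (hy y h).1,
    intervalIntegral.integral_congr fun y h => (hy y h).2]

/-- When `F` vanishes at infinity, the difference quotient at `z` equals `-F z / ζ` up to `o(1 /
ζ)`, so only the `1 / ζ` term survives on large squares. -/
lemma norm_dslope_add_le {F : ℂ → ℂ} {z ζ : ℂ} {η N : ℝ} (hN : 0 < N) (hzN : 2 * ‖z‖ < N)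
    (hζ : N ≤ ‖ζ‖) (hF : ‖F ζ‖ ≤ η) :
    ‖dslope F z ζ + F z * ζ⁻¹‖ ≤ (η + ‖z‖ * ‖F z‖ / N) * (2 / N) := by
  have h1 : N / 2 ≤ ‖ζ - z‖ := by
    have := norm_sub_norm_le ζ z
    linarith
  have hζz : ζ - z ≠ 0 := norm_pos_iff.1 (by linarith)
  have hζ0 : ζ ≠ 0 := norm_pos_iff.1 (by linarith)
  have e : dslope F z ζ + F z * ζ⁻¹ = (F ζ - z * F z / ζ) * (ζ - z)⁻¹ := by
    rw [dslope_of_ne _ (sub_ne_zero.1 hζz), slope_def_field]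
    field_simp
    ring
  rw [e, norm_mul, norm_inv]
  have h3 : ‖ζ - z‖⁻¹ ≤ 2 / N := by
    rw [inv_le_comm₀ (by linarith) (by positivity), inv_div]
    exact h1
  have h4 : ‖F ζ - z * F z / ζ‖ ≤ η + ‖z‖ * ‖F z‖ / N := by
    refine (norm_sub_le _ _).trans (add_le_add hF ?_)
    rw [norm_div, norm_mul]
    gcongr
  exact mul_le_mul h4 h3 (by positivity) ((norm_nonneg _).trans h4)

/-- Cauchy's formula in the exterior of a rectangle, for a function vanishing at infinity. -/
lemma rectIntegral_div_sub {F : ℂ → ℂ} {M R δ : ℝ} {z : ℂ}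
    (hF : DifferentiableOn ℂ F (slitCompl M)) (h0 : Tendsto F (Bornology.cobounded ℂ) (𝓝 0))
    (hMR : M < R) (hR : 0 < R) (hδ : 0 < δ) (hz : δ < |z.im|) :
    rectIntegral (fun ζ => F ζ / (ζ - z)) (-R) R (-δ) δ = -(2 * Real.pi * I * F z) := by
  have hzS : z ∈ slitCompl M := mem_slitCompl.2 <| Or.inl fun h => by
    rw [h, abs_zero] at hz; linarith
  -- `dslope` fills in the removable singularity at `z`, so the contour can be enlarged past `z`.
  have hq : DifferentiableOn ℂ (dslope F z) (slitCompl M) :=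
    (Complex.differentiableOn_dslope ((isOpen_slitCompl M).mem_nhds hzS)).2 hF
  have hne : ∀ x y : ℝ, |y| ≤ δ → (x + y * I : ℂ) ≠ z := by
    rintro x y hy rfl
    simp at hz
    linarith
  have yb : ∀ y ∈ [[-δ, δ]], |y| ≤ δ := fun y hy => by
    rw [uIcc_of_le (by linarith)] at hy
    exact abs_le.2 hy
  have bdS : ∀ x y : ℝ, (y ≠ 0 ∨ R ≤ |x|) → |y| ≤ δ →
      (x + y * I : ℂ) ∈ slitCompl M ∩ {z}ᶜ := by
    intro x y h hy
    refine ⟨mem_slitCompl.2 ?_, hne x y hy⟩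
    rcases h with h | h
    · left; simpa using h
    · right; simpa using hMR.trans_le h
  have bx : ∀ x ∈ [[-R, R]], (x + (-δ : ℝ) * I : ℂ) ∈ slitCompl M ∩ {z}ᶜ ∧
      (x + δ * I : ℂ) ∈ slitCompl M ∩ {z}ᶜ := fun x _ =>
    ⟨bdS _ _ (Or.inl (by linarith)) (by rw [abs_neg, abs_of_pos hδ]),
      bdS _ _ (Or.inl hδ.ne') (by rw [abs_of_pos hδ])⟩
  have by' : ∀ y ∈ [[-δ, δ]], ((-R : ℝ) + y * I : ℂ) ∈ slitCompl M ∩ {z}ᶜ ∧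
      (R + y * I : ℂ) ∈ slitCompl M ∩ {z}ᶜ := fun y hy =>
    ⟨bdS _ _ (Or.inr (by rw [abs_neg, abs_of_pos hR])) (yb y hy),
      bdS _ _ (Or.inr (by rw [abs_of_pos hR])) (yb y hy)⟩
  have ptw : ∀ ζ ∈ slitCompl M ∩ {z}ᶜ,
      F ζ / (ζ - z) = dslope F z ζ + F z * (ζ - z)⁻¹ := by
    rintro ζ ⟨-, hζ⟩
    have : ζ - z ≠ 0 := sub_ne_zero.2 hζ
    rw [dslope_of_ne _ hζ, slope_def_field]
    field_simp
    ring
  have hKc : ContinuousOn (fun ζ : ℂ => (ζ - z)⁻¹) (slitCompl M ∩ {z}ᶜ) :=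
    ContinuousOn.inv₀ (by fun_prop) fun ζ hζ => sub_ne_zero.2 hζ.2
  -- The point `z` lies outside the thin rectangle, so its Cauchy kernel integrates to zero.
  have hK0 : rectIntegral (fun ζ : ℂ => (ζ - z)⁻¹) (-R) R (-δ) δ = 0 := by
    apply rectIntegral_eq_zero
    refine DifferentiableOn.inv (by fun_prop) fun ζ hζ => sub_ne_zero.2 ?_
    have := hne ζ.re ζ.im (yb _ hζ.2)
    rwa [re_add_im] at this
  have e1 : rectIntegral (fun ζ => F ζ / (ζ - z)) (-R) R (-δ) δ =
      rectIntegral (dslope F z) (-R) R (-δ) δ := by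
    rw [rectIntegral_congr (K := fun ζ => dslope F z ζ + F z * (ζ - z)⁻¹)
      (fun x hx => ⟨ptw _ (bx x hx).1, ptw _ (bx x hx).2⟩)
      (fun y hy => ⟨ptw _ (by' y hy).1, ptw _ (by' y hy).2⟩),
      rectIntegral_linear (hq.continuousOn.mono inter_subset_left) hKc (F z) bx by', hK0,
      mul_zero, add_zero]
  rw [e1, eq_neg_iff_add_eq_zero, ← norm_eq_zero]
  refine le_antisymm (le_of_forall_pos_le_add fun η hη => ?_) (norm_nonneg _)
  -- The square has perimeter `8N`, the error is at most `2 / N` times two terms of size `η / 32`: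
  -- in total `η`.
  have hη' : 0 < η / 32 := by positivity
  have ev := h0.eventually (Metric.ball_mem_nhds (0 : ℂ) hη')
  obtain ⟨r, -, hr⟩ := (hasBasis_cobounded_norm (E := ℂ)).eventually_iff.1 ev
  set N : ℝ := max (max (r + 1) (2 * ‖z‖ + 1))
    (max (max R δ) (‖z‖ * ‖F z‖ / (η / 32))) with hNdef
  have N1 : r ≤ N := by linarith [(le_max_left (r + 1) (2 * ‖z‖ + 1)).trans (le_max_left _ _ : _ ≤ N)]
  have N2 : 2 * ‖z‖ < N := by
    linarith [(le_max_right (r + 1) (2 * ‖z‖ + 1)).trans (le_max_left _ _ : _ ≤ N)]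
  have N3 : R ≤ N := (le_max_left R δ).trans ((le_max_left _ _).trans (le_max_right _ _))
  have N4 : δ ≤ N := (le_max_right R δ).trans ((le_max_left _ _).trans (le_max_right _ _))
  have N5 : ‖z‖ * ‖F z‖ / (η / 32) ≤ N := (le_max_right _ _).trans (le_max_right _ _)
  have N0 : 0 < N := by linarith
  clear_value N
  have N6 : ‖z‖ * ‖F z‖ / N ≤ η / 32 := by
    rw [div_le_iff₀ hη'] at N5
    rw [div_le_iff₀ N0]
    linarith
  have hb := norm_rectIntegral_square_le (H := fun ζ => dslope F z ζ + F z * ζ⁻¹) N0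
    (B := (η / 32 + ‖z‖ * ‖F z‖ / N) * (2 / N)) fun ζ hζ =>
      norm_dslope_add_le N0 N2 hζ (by simpa using (hr (N1.trans hζ)).le)
  have hsq : ∀ x y : ℝ, N ≤ |x| ∨ N ≤ |y| → (x + y * I : ℂ) ∈ slitCompl M ∩ {0}ᶜ := by
    intro x y h
    refine ⟨mem_slitCompl.2 ?_, fun h0 => ?_⟩
    · rcases h with h | h
      · right; simpa using hMR.trans_le (N3.trans h)
      · left
        have : 0 < |y| := by linarith
        simpa using abs_pos.1 this
    · have h1 := congrArg Complex.re h0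
      have h2 := congrArg Complex.im h0
      simp at h1 h2
      rw [h1, h2, abs_zero] at h
      rcases h with h | h <;> linarith
  rw [rectIntegral_linear (S := slitCompl M ∩ {0}ᶜ) (hq.continuousOn.mono inter_subset_left)
    (continuousOn_inv₀.mono inter_subset_right) (F z)
    (fun x _ => ⟨hsq _ _ (Or.inr (by rw [abs_neg, abs_of_pos N0])),
      hsq _ _ (Or.inr (by rw [abs_of_pos N0]))⟩)
    (fun x _ => ⟨hsq _ _ (Or.inl (by rw [abs_neg, abs_of_pos N0])),
      hsq _ _ (Or.inl (by rw [abs_of_pos N0]))⟩),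
    rectIntegral_inv_square N0, rectIntegral_frame hq hMR hR N3 hδ N4] at hb
  rw [mul_comm (2 * (Real.pi : ℂ) * I) (F z), zero_add]
  refine hb.trans ?_
  calc 8 * N * ((η / 32 + ‖z‖ * ‖F z‖ / N) * (2 / N))
      = 16 * (η / 32 + ‖z‖ * ‖F z‖ / N) := by field_simp; ring
    _ ≤ 16 * (η / 32 + η / 32) := by gcongr
    _ = η := by ring

/-! ### Exponential integrals and uniqueness of half-line Laplace transforms. -/

/-- `∫ x, w x * exp (i t γ x) ∂μ`, as a function of the complex variable `t`. -/
def expIntegral (μ : Measure ℝ) (w γ : ℝ → ℂ) (t : ℂ) : ℂ :=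
  ∫ s, w s * cexp (I * t * γ s) ∂μ

lemma differentiable_expIntegral {μ : Measure ℝ} {w γ : ℝ → ℂ} (hw : Integrable w μ)
    (hγ : AEStronglyMeasurable γ μ) {B : ℝ} (hB : ∀ᵐ s ∂μ, ‖γ s‖ ≤ B) :
    Differentiable ℂ (expIntegral μ w γ) := by
  intro t₀
  have hm : ∀ t : ℂ, AEStronglyMeasurable (fun s => cexp (I * t * γ s)) μ := fun t =>
    Complex.continuous_exp.comp_aestronglyMeasurable (hγ.const_mul (I * t))
  have bd : ∀ t : ℂ, ∀ s, ‖γ s‖ ≤ B → ‖cexp (I * t * γ s)‖ ≤ Real.exp (‖t‖ * B) := by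
    intro t s hs
    rw [Complex.norm_exp]
    apply Real.exp_le_exp.2
    refine (Complex.re_le_norm _).trans ?_
    rw [norm_mul, norm_mul, norm_I, one_mul]
    gcongr
  have hint : Integrable (fun s => w s * cexp (I * t₀ * γ s)) μ :=
    hw.mul_bdd (c := Real.exp (‖t₀‖ * B)) (hm t₀) (by filter_upwards [hB] with s hs using bd _ s hs)
  have := hasDerivAt_integral_of_dominated_loc_of_deriv_le (μ := μ) (x₀ := t₀)
    (s := Metric.ball t₀ 1) (F := fun t s => w s * cexp (I * t * γ s))
    (F' := fun t s => w s * (cexp (I * t * γ s) * (I * γ s)))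
    (bound := fun s => ‖w s‖ * (Real.exp ((‖t₀‖ + 1) * B) * B))
    (Metric.ball_mem_nhds _ one_pos)
    (Eventually.of_forall fun t => hw.1.mul (hm t)) hint
    (hw.1.mul ((hm t₀).mul (hγ.const_mul I)))
    (by
      filter_upwards [hB] with s hs t ht
      have hB0 : 0 ≤ B := (norm_nonneg _).trans hs
      rw [norm_mul, norm_mul, norm_mul, norm_I, one_mul]
      gcongr
      refine (bd t s hs).trans (Real.exp_le_exp.2 ?_)
      gcongr
      have := norm_sub_norm_le t t₀
      rw [Metric.mem_ball, dist_eq_norm] at ht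
      linarith)
    (hw.norm.mul_const _)
    (Eventually.of_forall fun s t _ => by
      have h : HasDerivAt (fun t : ℂ => I * t * γ s) (I * γ s) t := by
        simpa using ((hasDerivAt_id t).const_mul I).mul_const (γ s)
      exact h.cexp.const_mul (w s))
  exact this.2.differentiableAt

lemma norm_expIntegral_le {μ : Measure ℝ} {w γ : ℝ → ℂ} (hw : Integrable w μ) {t : ℂ} {E : ℝ}
    (hE : ∀ᵐ s ∂μ, (I * t * γ s).re ≤ E) :
    ‖expIntegral μ w γ t‖ ≤ (∫ s, ‖w s‖ ∂μ) * Real.exp E := by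
  rw [← integral_mul_const]
  refine norm_integral_le_of_norm_le (hw.norm.mul_const _) ?_
  filter_upwards [hE] with s hs
  rw [norm_mul, Complex.norm_exp]
  gcongr

/-- Every smooth compactly supported test function is the Fourier transform of a Schwartz function;
the self-adjointness of the transform moves it onto `v`, where it vanishes. -/
lemma ae_eq_zero_of_fourier_eq_zero {v : ℝ → ℂ} (hv : Integrable v) (h : 𝓕 v = 0) :
    ∀ᵐ x, v x = 0 := by
  refine ae_eq_zero_of_integral_contDiff_smul_eq_zero hv.locallyIntegrable fun φ hφ hc => ?_
  have hg₁ : HasCompactSupport (Complex.ofRealCLM ∘ φ) := hc.comp_left rfl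
  have hg₂ : ContDiff ℝ ∞ (Complex.ofRealCLM ∘ φ) := by fun_prop
  set Φ := hg₁.toSchwartzMap hg₂ with hΦ
  set Ψ := 𝓕⁻ Φ with hΨ
  have e1 : 𝓕 (Ψ : ℝ → ℂ) = Φ := by
    rw [← SchwartzMap.fourier_coe, hΨ, FourierTransform.fourier_fourierInv_eq]
  have := VectorFourier.integral_fourierIntegral_smul_eq_flip (L := innerₗ ℝ) (μ := volume)
    (ν := volume) (f := (Ψ : ℝ → ℂ)) (g := v) Real.continuous_fourierChar continuous_inner
    Ψ.integrable hv
  have e2 : VectorFourier.fourierIntegral Real.fourierChar volume (innerₗ ℝ).flip v = 0 := by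
    rw [flip_innerₗ]; exact h
  have e3 : VectorFourier.fourierIntegral Real.fourierChar volume (innerₗ ℝ) (Ψ : ℝ → ℂ) = Φ := e1
  rw [e2, e3] at this
  simpa [hΦ] using this

/-- `g` has half-line Laplace transforms outside the strip `|Im z| ≤ δ`, given by `Φ`. -/
def LaplacePair (δ : ℝ) (g : ℝ → ℂ) (Φ : ℂ → ℂ) : Prop :=
  (∀ z : ℂ, z.im < -δ → IntegrableOn (fun t : ℝ => g t * cexp (-I * t * z)) (Ici 0) ∧
    ∫ t in Ici (0 : ℝ), g t * cexp (-I * t * z) = Φ z) ∧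
  (∀ z : ℂ, δ < z.im → IntegrableOn (fun t : ℝ => g t * cexp (-I * t * z)) (Iic 0) ∧
    ∫ t in Iic (0 : ℝ), g t * cexp (-I * t * z) = -Φ z)

namespace LaplacePair

variable {δ : ℝ} {g k : ℝ → ℂ} {Φ Ψ : ℂ → ℂ}

lemma add (hg : LaplacePair δ g Φ) (hk : LaplacePair δ k Ψ) :
    LaplacePair δ (fun t => g t + k t) (fun z => Φ z + Ψ z) := by
  refine ⟨fun z hz => ?_, fun z hz => ?_⟩
  · obtain ⟨i1, e1⟩ := hg.1 z hz
    obtain ⟨i2, e2⟩ := hk.1 z hz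
    simp_rw [add_mul]
    exact ⟨i1.add i2, by rw [integral_add i1 i2, e1, e2]⟩
  · obtain ⟨i1, e1⟩ := hg.2 z hz
    obtain ⟨i2, e2⟩ := hk.2 z hz
    simp_rw [add_mul]
    exact ⟨i1.add i2, by rw [integral_add i1 i2, e1, e2]; ring⟩

lemma const_mul (hg : LaplacePair δ g Φ) (c : ℂ) :
    LaplacePair δ (fun t => c * g t) (fun z => c * Φ z) := by
  refine ⟨fun z hz => ?_, fun z hz => ?_⟩
  · obtain ⟨i1, e1⟩ := hg.1 z hz
    simp_rw [mul_assoc c]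
    exact ⟨i1.const_mul c, by rw [integral_const_mul, e1]⟩
  · obtain ⟨i1, e1⟩ := hg.2 z hz
    simp_rw [mul_assoc c]
    exact ⟨i1.const_mul c, by rw [integral_const_mul, e1]; ring⟩

lemma sub (hg : LaplacePair δ g Φ) (hk : LaplacePair δ k Ψ) :
    LaplacePair δ (fun t => g t - k t) (fun z => Φ z - Ψ z) := by
  simpa [sub_eq_add_neg] using hg.add (hk.const_mul (-1))

lemma congr_right (hg : LaplacePair δ g Φ) (h : ∀ z : ℂ, δ < |z.im| → Φ z = Ψ z) :
    LaplacePair δ g Ψ :=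
  ⟨fun z hz => h z (lt_abs.2 (Or.inr (by linarith))) ▸ hg.1 z hz,
    fun z hz => h z (lt_abs.2 (Or.inl hz)) ▸ hg.2 z hz⟩

/-- After damping by `exp (-l |t|)` with `l > δ`, the Fourier integral at `ξ` is the sum of the two
half-line transforms at `2πξ ± li`, and both are zero. -/
lemma ae_eq_zero (hg : LaplacePair δ g 0) : ∀ᵐ t, g t = 0 := by
  set l : ℝ := δ + 1 with hl
  set v : ℝ → ℂ := fun t => g t * Real.exp (-l * |t|) with hv
  have low : ∀ ξ : ℝ, (2 * Real.pi * ξ - l * I : ℂ).im < -δ := fun ξ => by simp [hl]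
  have upp : ∀ ξ : ℝ, δ < (2 * Real.pi * ξ + l * I : ℂ).im := fun ξ => by simp [hl]
  have epos : ∀ ξ : ℝ, ∀ t ∈ Ici (0 : ℝ), cexp (↑(-2 * Real.pi * t * ξ) * I) • v t =
      g t * cexp (-I * t * (2 * Real.pi * ξ - l * I)) := by
    intro ξ t ht
    rw [hv, smul_eq_mul]
    dsimp only
    rw [abs_of_nonneg ht, mul_left_comm, Complex.ofReal_exp, ← Complex.exp_add]
    congr 2
    push_cast
    linear_combination (-(t : ℂ) * l) * I_sq
  have eneg : ∀ ξ : ℝ, ∀ t ∈ Iic (0 : ℝ), cexp (↑(-2 * Real.pi * t * ξ) * I) • v t =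
      g t * cexp (-I * t * (2 * Real.pi * ξ + l * I)) := by
    intro ξ t ht
    rw [hv, smul_eq_mul]
    dsimp only
    rw [abs_of_nonpos ht, mul_left_comm, Complex.ofReal_exp, ← Complex.exp_add]
    congr 2
    push_cast
    linear_combination ((t : ℂ) * l) * I_sq
  have ipos : ∀ ξ : ℝ, IntegrableOn (fun t : ℝ => cexp (↑(-2 * Real.pi * t * ξ) * I) • v t)
      (Ici 0) := fun ξ =>
    ((hg.1 _ (low ξ)).1).congr_fun (fun t ht => (epos ξ t ht).symm) measurableSet_Ici
  have ineg : ∀ ξ : ℝ, IntegrableOn (fun t : ℝ => cexp (↑(-2 * Real.pi * t * ξ) * I) • v t)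
      (Iic 0) := fun ξ =>
    ((hg.2 _ (upp ξ)).1).congr_fun (fun t ht => (eneg ξ t ht).symm) measurableSet_Iic
  have iall : ∀ ξ : ℝ, Integrable (fun t : ℝ => cexp (↑(-2 * Real.pi * t * ξ) * I) • v t) := by
    intro ξ
    rw [← integrableOn_univ, ← Iic_union_Ici (a := (0 : ℝ))]
    exact (ineg ξ).union (ipos ξ)
  have hvint : Integrable v := by simpa using iall 0
  have hF : 𝓕 v = 0 := by
    ext ξ
    rw [Real.fourier_real_eq_integral_exp_smul, ← intervalIntegral.integral_Iic_add_Ioi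
      (b := (0 : ℝ)) (iall ξ).integrableOn (iall ξ).integrableOn, ← integral_Ici_eq_integral_Ioi,
      setIntegral_congr_fun measurableSet_Iic (eneg ξ),
      setIntegral_congr_fun measurableSet_Ici (epos ξ), (hg.1 _ (low ξ)).2, (hg.2 _ (upp ξ)).2]
    simp
  filter_upwards [ae_eq_zero_of_fourier_eq_zero hvint hF] with t ht
  exact (mul_eq_zero.1 ht).resolve_right (by exact_mod_cast (Real.exp_pos _).ne')

end LaplacePair

lemma laplacePair_of_extendsCarleman {f : ℝ → ℝ} {F : ℂ → ℂ} (hf : CarlemanClass f)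
    (hF : ExtendsCarleman f F) : LaplacePair 0 (fun t => (f t : ℂ)) (fun z => -F z) := by
  have meas : AEStronglyMeasurable (fun t => (f t : ℂ)) volume :=
    Complex.continuous_ofReal.comp_aestronglyMeasurable hf.1.aestronglyMeasurable
  have mexp : ∀ z : ℂ, AEStronglyMeasurable (fun t : ℝ => (f t : ℂ) * cexp (-I * t * z)) volume :=
    fun z => meas.mul (by fun_prop : Continuous fun t : ℝ => cexp (-I * t * z)).aestronglyMeasurable
  have nrm : ∀ (z : ℂ) (t : ℝ), ‖(f t : ℂ) * cexp (-I * t * z)‖ = |f t| * Real.exp (t * z.im) := by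
    intro z t
    rw [norm_mul, Complex.norm_exp, Complex.norm_real, Real.norm_eq_abs]
    congr 2
    simp [mul_re, mul_im]
  refine ⟨fun z hz => ⟨?_, ?_⟩, fun z hz => ⟨?_, ?_⟩⟩
  · refine ((hf.2 (-z.im) (by linarith)).integrableOn (s := Ici 0)).mono' (mexp z).restrict ?_
    filter_upwards [ae_restrict_mem measurableSet_Ici] with t ht
    rw [nrm, abs_of_nonneg (a := t) ht]
    apply le_of_eq; ring_nf
  · dsimp only
    rw [hF.2 z (by linarith), carlemanMinus, neg_neg]
  · refine ((hf.2 z.im hz).integrableOn (s := Iic 0)).mono' (mexp z).restrict ?_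
    filter_upwards [ae_restrict_mem measurableSet_Iic] with t ht
    rw [nrm, abs_of_nonpos (a := t) ht]
    apply le_of_eq; ring_nf
  · dsimp only
    rw [hF.1 z (by linarith), carlemanPlus, neg_neg]

/-- Fubini: below the strip `|Im| ≤ δ` the exponential decays in `t` uniformly in `s`, and the inner
integral is elementary. -/
lemma expIntegral_halfLine {μ : Measure ℝ} [SFinite μ] {w γ : ℝ → ℂ} (hw : Integrable w μ)
    (hγ : AEStronglyMeasurable γ μ) {δ : ℝ} (hδ : ∀ᵐ s ∂μ, |(γ s).im| ≤ δ) {z : ℂ}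
    (hz : z.im < -δ) :
    IntegrableOn (fun t : ℝ => expIntegral μ w γ t * cexp (-I * t * z)) (Ioi 0) ∧
    ∫ t in Ioi (0 : ℝ), expIntegral μ w γ t * cexp (-I * t * z) =
      ∫ s, w s * (I / (γ s - z)) ∂μ := by
  set κ : ℝ := -δ - z.im with hκ
  have hκ0 : 0 < κ := by linarith
  have hint : Integrable (fun p : ℝ × ℝ => w p.2 * cexp (I * p.1 * (γ p.2 - z)))
      ((volume.restrict (Ioi 0)).prod μ) := by
    have i1 : Integrable (fun t : ℝ => Real.exp (-κ * t)) (volume.restrict (Ioi 0)) :=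
      exp_neg_integrableOn_Ioi 0 hκ0
    refine (i1.mul_prod hw.norm).mono' ?_ ?_
    · refine (hw.1.comp_snd).mul (Complex.continuous_exp.comp_aestronglyMeasurable ?_)
      refine AEStronglyMeasurable.mul ?_ (hγ.comp_snd.sub aestronglyMeasurable_const)
      exact (by fun_prop : Continuous fun p : ℝ × ℝ => I * (p.1 : ℂ)).aestronglyMeasurable
    · have a1 : ∀ᵐ p : ℝ × ℝ ∂((volume.restrict (Ioi 0)).prod μ), p.1 ∈ Ioi (0 : ℝ) :=
        Measure.quasiMeasurePreserving_fst.ae (ae_restrict_mem measurableSet_Ioi)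
      have a2 : ∀ᵐ p : ℝ × ℝ ∂((volume.restrict (Ioi 0)).prod μ), |(γ p.2).im| ≤ δ :=
        Measure.quasiMeasurePreserving_snd.ae hδ
      filter_upwards [a1, a2] with p h1 h2
      rw [norm_mul, Complex.norm_exp, mul_comm]
      gcongr
      have := (abs_le.1 h2).1
      have h1' : 0 < p.1 := h1
      simp only [mul_re, I_re, ofReal_re, I_im, ofReal_im, mul_im, sub_re, sub_im]
      nlinarith
  have e0 : ∀ t : ℝ, expIntegral μ w γ t * cexp (-I * t * z) =
      ∫ s, w s * cexp (I * t * (γ s - z)) ∂μ := by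
    intro t
    rw [expIntegral, ← integral_mul_const]
    congr 1 with s
    rw [mul_assoc, ← Complex.exp_add]
    ring_nf
  simp_rw [e0]
  refine ⟨hint.integral_prod_left, ?_⟩
  rw [integral_integral_swap hint]
  refine integral_congr_ae ?_
  filter_upwards [hδ] with s hs
  have h1 := (abs_le.1 hs).1
  have hre : (I * (γ s - z)).re < 0 := by
    simp only [mul_re, I_re, I_im, sub_im]
    linarith
  have := integral_exp_mul_complex_Ioi hre 0
  rw [integral_const_mul]
  congr 1
  rw [show (fun t : ℝ => cexp (I * t * (γ s - z))) = fun t : ℝ => cexp (I * (γ s - z) * t) by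
    ext t; ring_nf, this]
  have hne : γ s - z ≠ 0 := fun h => by rw [h] at hre; simp at hre
  simp only [ofReal_zero, mul_zero, Complex.exp_zero]
  field_simp
  rw [I_sq]

lemma laplacePair_expIntegral {μ : Measure ℝ} [SFinite μ] {w γ : ℝ → ℂ} (hw : Integrable w μ)
    (hγ : AEStronglyMeasurable γ μ) {δ : ℝ} (hδ : ∀ᵐ s ∂μ, |(γ s).im| ≤ δ) :
    LaplacePair δ (fun t => expIntegral μ w γ t) (fun z => ∫ s, w s * (I / (γ s - z)) ∂μ) := by
  refine ⟨fun z hz => ?_, fun z hz => ?_⟩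
  · rw [integral_Ici_eq_integral_Ioi, integrableOn_Ici_iff_integrableOn_Ioi]
    exact expIntegral_halfLine hw hγ hδ hz
  -- The upper half-plane reduces to the lower one by changing the signs of `t`, `γ` and `z`.
  · have h := expIntegral_halfLine (z := -z) hw hγ.neg (by simpa using hδ) (by simpa using hz)
    have e : (fun t : ℝ => expIntegral μ w γ t * cexp (-I * t * z)) = fun t : ℝ =>
        (fun t : ℝ => expIntegral μ w (-γ) t * cexp (-I * t * (-z))) (-t) := by
      ext t
      simp [expIntegral]
    rw [e]
    constructor
    · have := (integrableOn_Ici_iff_integrableOn_Ioi (μ := volume)).2 h.1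
      simpa using this.comp_neg
    · have := integral_comp_neg_Iic (0 : ℝ)
        (fun t : ℝ => expIntegral μ w (-γ) t * cexp (-I * t * (-z)))
      rw [this, neg_zero, h.2, ← integral_neg]
      congr 1 with s
      have : (-γ) s - -z = -(γ s - z) := by simp [Pi.neg_apply]; ring
      rw [this, div_neg, mul_neg]

/-- The contour integral of `H ζ * exp (i t ζ)` over the boundary of `[x₁, x₂] × [-δ, δ]`. -/
def rectExp (H : ℂ → ℂ) (x₁ x₂ δ : ℝ) (t : ℂ) : ℂ :=
  rectIntegral (fun ζ => H ζ * cexp (I * t * ζ)) x₁ x₂ (-δ) δ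

section RectExp

variable {H : ℂ → ℂ} {x₁ x₂ δ : ℝ}

/-- `H` is continuous along the four sides of `[x₁, x₂] × [-δ, δ]`. -/
structure ContinuousOnSides (H : ℂ → ℂ) (x₁ x₂ δ : ℝ) : Prop where
  le : x₁ ≤ x₂
  nonneg : 0 ≤ δ
  bot : ContinuousOn (fun x : ℝ => H (x + (-δ : ℝ) * I)) [[x₁, x₂]]
  top : ContinuousOn (fun x : ℝ => H (x + δ * I)) [[x₁, x₂]]
  right : ContinuousOn (fun y : ℝ => H (x₂ + y * I)) [[-δ, δ]]
  left : ContinuousOn (fun y : ℝ => H (x₁ + y * I)) [[-δ, δ]]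

lemma ContinuousOn.continuousOnSides {S : Set ℂ} (hH : ContinuousOn H S) (hx : x₁ ≤ x₂)
    (hδ : 0 ≤ δ) (hxS : ∀ x ∈ [[x₁, x₂]], (x + (-δ : ℝ) * I : ℂ) ∈ S ∧ (x + δ * I : ℂ) ∈ S)
    (hyS : ∀ y ∈ [[-δ, δ]], (x₁ + y * I : ℂ) ∈ S ∧ (x₂ + y * I : ℂ) ∈ S) :
    ContinuousOnSides H x₁ x₂ δ where
  le := hx
  nonneg := hδ
  bot := continuousOn_horizontal hH fun x h => (hxS x h).1
  top := continuousOn_horizontal hH fun x h => (hxS x h).2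
  right := continuousOn_vertical hH fun y h => (hyS y h).2
  left := continuousOn_vertical hH fun y h => (hyS y h).1

lemma rectExp_eq (hx : x₁ ≤ x₂) (hδ : 0 ≤ δ) (t : ℂ) :
    rectExp H x₁ x₂ δ t =
      expIntegral (volume.restrict (Ioc x₁ x₂)) (fun x : ℝ => H (x + (-δ : ℝ) * I))
          (fun x : ℝ => x + (-δ : ℝ) * I) t
        - expIntegral (volume.restrict (Ioc x₁ x₂)) (fun x : ℝ => H (x + δ * I))
          (fun x : ℝ => x + δ * I) t
        + I * expIntegral (volume.restrict (Ioc (-δ) δ)) (fun y : ℝ => H (x₂ + y * I))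
          (fun y : ℝ => x₂ + y * I) t
        - I * expIntegral (volume.restrict (Ioc (-δ) δ)) (fun y : ℝ => H (x₁ + y * I))
          (fun y : ℝ => x₁ + y * I) t := by
  have hδ' : -δ ≤ δ := by linarith
  simp only [rectExp, rectIntegral, intervalIntegral.integral_of_le hx,
    intervalIntegral.integral_of_le hδ', expIntegral]

lemma ContinuousOn.integrable_Ioc {u : ℝ → ℂ} {p q : ℝ} (hpq : p ≤ q)
    (h : ContinuousOn u [[p, q]]) : Integrable u (volume.restrict (Ioc p q)) := by
  have := h.intervalIntegrable (μ := volume)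
  rwa [intervalIntegrable_iff_integrableOn_Ioc_of_le hpq] at this

lemma ae_Ioc_of_forall {p q : ℝ} {P : ℝ → Prop} (h : ∀ x ∈ Icc p q, P x) :
    ∀ᵐ x ∂(volume.restrict (Ioc p q)), P x := by
  filter_upwards [ae_restrict_mem measurableSet_Ioc] with x hx
  exact h x (Ioc_subset_Icc_self hx)

namespace ContinuousOnSides

lemma differentiable_rectExp (h : ContinuousOnSides H x₁ x₂ δ) :
    Differentiable ℂ (rectExp H x₁ x₂ δ) := by
  have hδ' : -δ ≤ δ := by linarith [h.nonneg]
  have side : ∀ {p q : ℝ} {w γ : ℝ → ℂ}, p ≤ q → ContinuousOn w [[p, q]] → Continuous γ →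
      Differentiable ℂ (expIntegral (volume.restrict (Ioc p q)) w γ) := by
    intro p q w γ hpq hw hγ
    obtain ⟨B, hB⟩ := (isCompact_Icc (a := p) (b := q)).exists_bound_of_continuousOn hγ.continuousOn
    exact differentiable_expIntegral (ContinuousOn.integrable_Ioc hpq hw) hγ.aestronglyMeasurable
      (ae_Ioc_of_forall hB)
  have e : rectExp H x₁ x₂ δ = _ := funext fun t => rectExp_eq h.le h.nonneg t
  rw [e]
  exact (((side h.le h.bot (by fun_prop)).sub (side h.le h.top (by fun_prop))).add
    ((side hδ' h.right (by fun_prop)).const_mul I)).sub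
    ((side hδ' h.left (by fun_prop)).const_mul I)

/-- The constant is the integral of `‖H‖` along the four sides, independent of `t`: growth in `t` is
governed by the exponent alone. -/
lemma exists_norm_rectExp_le (h : ContinuousOnSides H x₁ x₂ δ) :
    ∃ C : ℝ, 0 ≤ C ∧ ∀ (t : ℂ) (E : ℝ),
      (∀ x ∈ Icc x₁ x₂, ∀ y ∈ Icc (-δ) δ, (I * t * (x + y * I)).re ≤ E) →
      ‖rectExp H x₁ x₂ δ t‖ ≤ C * Real.exp E := by
  have hδ := h.nonneg
  have hδ' : -δ ≤ δ := by linarith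
  refine ⟨(∫ x in Ioc x₁ x₂, ‖H (x + (-δ : ℝ) * I)‖) + (∫ x in Ioc x₁ x₂, ‖H (x + δ * I)‖) +
    (∫ y in Ioc (-δ) δ, ‖H (x₂ + y * I)‖) + (∫ y in Ioc (-δ) δ, ‖H (x₁ + y * I)‖), ?_, ?_⟩
  · refine add_nonneg (add_nonneg (add_nonneg ?_ ?_) ?_) ?_ <;>
      exact integral_nonneg fun _ => norm_nonneg _
  · intro t E hE
    rw [rectExp_eq h.le h.nonneg]
    have b1 := norm_expIntegral_le (ContinuousOn.integrable_Ioc h.le h.bot) (t := t)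
      (ae_Ioc_of_forall fun x hx => hE x hx (-δ) ⟨le_rfl, hδ'⟩)
    have b2 := norm_expIntegral_le (ContinuousOn.integrable_Ioc h.le h.top) (t := t)
      (ae_Ioc_of_forall fun x hx => hE x hx δ ⟨hδ', le_rfl⟩)
    have b3 := norm_expIntegral_le (ContinuousOn.integrable_Ioc hδ' h.right) (t := t)
      (ae_Ioc_of_forall fun y hy => hE x₂ ⟨h.le, le_rfl⟩ y hy)
    have b4 := norm_expIntegral_le (ContinuousOn.integrable_Ioc hδ' h.left) (t := t)
      (ae_Ioc_of_forall fun y hy => hE x₁ ⟨le_rfl, h.le⟩ y hy)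
    refine (norm_sub_le _ _).trans ?_
    refine (add_le_add (norm_add_le _ _) le_rfl).trans ?_
    refine (add_le_add (add_le_add (norm_sub_le _ _) le_rfl) le_rfl).trans ?_
    rw [norm_mul, norm_mul, norm_I, one_mul, one_mul]
    linarith

/-- The transform of each exponential is a Cauchy kernel, so the transform of the contour integral
is a Cauchy integral, which `rectIntegral_div_sub` evaluates. -/
lemma laplacePair (h : ContinuousOnSides H x₁ x₂ δ) :
    LaplacePair δ (fun t : ℝ => rectExp H x₁ x₂ δ t)
      (fun z => I * rectIntegral (fun ζ => H ζ / (ζ - z)) x₁ x₂ (-δ) δ) := by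
  have hδ := h.nonneg
  have hδ' : -δ ≤ δ := by linarith
  have side : ∀ {p q : ℝ} {w γ : ℝ → ℂ}, p ≤ q → ContinuousOn w [[p, q]] → Continuous γ →
      (∀ s ∈ Icc p q, |(γ s).im| ≤ δ) →
      LaplacePair δ (fun t => expIntegral (volume.restrict (Ioc p q)) w γ t)
        (fun z => I * ∫ s in p..q, w s / (γ s - z)) := by
    intro p q w γ hpq hw hγ hb
    refine (laplacePair_expIntegral (ContinuousOn.integrable_Ioc hpq hw) hγ.aestronglyMeasurable
      (ae_Ioc_of_forall hb)).congr_right fun z _ => ?_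
    rw [intervalIntegral.integral_of_le hpq, ← integral_const_mul]
    congr 1 with s
    ring
  have l1 := side (γ := fun x : ℝ => x + (-δ : ℝ) * I) h.le h.bot (by fun_prop)
    fun x _ => by simp [abs_of_nonneg hδ]
  have l2 := side (γ := fun x : ℝ => x + δ * I) h.le h.top (by fun_prop)
    fun x _ => by simp [abs_of_nonneg hδ]
  have l3 := side (γ := fun y : ℝ => x₂ + y * I) hδ' h.right (by fun_prop)
    fun y hy => by simpa using abs_le.2 hy
  have l4 := side (γ := fun y : ℝ => x₁ + y * I) hδ' h.left (by fun_prop)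
    fun y hy => by simpa using abs_le.2 hy
  have := ((l1.sub l2).add (l3.const_mul I)).sub (l4.const_mul I)
  simp_rw [rectExp_eq h.le h.nonneg]
  refine this.congr_right fun z _ => ?_
  simp only [rectIntegral]
  ring

end ContinuousOnSides

end RectExp

/-! ### From the spectral gap to an entire function. -/

/-- Analyticity at infinity only provides some limit there; this dominated-convergence limit along
the negative imaginary axis identifies it as zero. -/
lemma tendsto_carlemanMinus {f : ℝ → ℝ} (hf : CarlemanClass f) :
    Tendsto (fun y : ℝ => carlemanMinus f (-(y * I))) atTop (𝓝 0) := by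
  have meas : AEStronglyMeasurable (fun t => (f t : ℂ)) volume :=
    Complex.continuous_ofReal.comp_aestronglyMeasurable hf.1.aestronglyMeasurable
  have key : Tendsto (fun y : ℝ => ∫ t in Ioi (0 : ℝ), (f t : ℂ) * cexp (-I * t * (-(y * I))))
      atTop (𝓝 (∫ t in Ioi (0 : ℝ), (0 : ℂ))) := by
    have nrm : ∀ (y t : ℝ), ‖(f t : ℂ) * cexp (-I * t * (-(y * I)))‖ =
        |f t| * Real.exp (-(t * y)) := by
      intro y t
      rw [norm_mul, Complex.norm_exp, Complex.norm_real, Real.norm_eq_abs]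
      congr 2
      simp [mul_re, mul_im]
    refine tendsto_integral_filter_of_dominated_convergence
      (fun t => |f t| * Real.exp (-1 * |t|)) ?_ ?_ (hf.2 1 one_pos).integrableOn ?_
    · exact Eventually.of_forall fun y => (meas.mul (by fun_prop : Continuous fun t : ℝ =>
        cexp (-I * t * (-(y * I)))).aestronglyMeasurable).restrict
    · filter_upwards [eventually_ge_atTop (1 : ℝ)] with y hy
      filter_upwards [ae_restrict_mem measurableSet_Ioi] with t ht
      rw [nrm, abs_of_pos (a := t) ht]
      gcongr
      have : 0 < t := ht
      nlinarith
    · filter_upwards [ae_restrict_mem measurableSet_Ioi] with t ht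
      rw [tendsto_zero_iff_norm_tendsto_zero]
      simp_rw [nrm]
      rw [← mul_zero |f t|]
      refine Tendsto.const_mul _ (Real.tendsto_exp_neg_atTop_nhds_zero.comp ?_)
      exact tendsto_id.const_mul_atTop ht
  simpa [carlemanMinus, integral_Ici_eq_integral_Ioi] using key.neg

/-- A single extension of the Carleman transform that is analytic outside `[-M, M]`, across the
spectral gap, and vanishes at infinity. -/
lemma exists_carleman_extension {f : ℝ → ℝ} {a : ℝ} (hf : CarlemanClass f)
    (hbdd : HasBoundedSpectrum f) (hgap : HasSpectralGap f a) :
    ∃ (F : ℂ → ℂ) (M : ℝ), a ≤ M ∧ ExtendsCarleman f F ∧ DifferentiableOn ℂ F (slitCompl M) ∧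
      DifferentiableOn ℂ F {z : ℂ | z.im ≠ 0 ∨ |z.re| < a} ∧
      Tendsto F (Bornology.cobounded ℂ) (𝓝 0) := by
  obtain ⟨b, hb, F₁, hF₁, hA₁, G, hG, hGF⟩ := hbdd
  obtain ⟨F₂, hF₂, hA₂⟩ := hgap
  have agree : ∀ z : ℂ, z.im ≠ 0 → F₁ z = F₂ z := by
    intro z hz
    rcases lt_or_gt_of_ne hz with h | h
    · rw [hF₁.2 z h, hF₂.2 z h]
    · rw [hF₁.1 z h, hF₂.1 z h]
  classical
  -- The two given extensions agree off the real axis, so one may be used over the gap and the other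
  -- elsewhere.
  set F : ℂ → ℂ := fun z => if |z.re| < a then F₂ z else F₁ z with hF
  have FF₁ : ∀ z : ℂ, (z.im ≠ 0 ∨ a ≤ |z.re|) → F z = F₁ z := by
    intro z hz
    rw [hF]
    dsimp only
    split_ifs with h
    · exact (agree z (hz.resolve_right (not_le.2 h))).symm
    · rfl
  have FF₂ : ∀ z : ℂ, (z.im ≠ 0 ∨ |z.re| < a) → F z = F₂ z := by
    intro z hz
    rw [hF]
    dsimp only
    split_ifs with h
    · rfl
    · exact agree z (hz.resolve_right h)
  have hext : ExtendsCarleman f F :=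
    ⟨fun z hz => by rw [FF₁ z (Or.inl hz.ne'), hF₁.1 z hz],
      fun z hz => by rw [FF₁ z (Or.inl hz.ne), hF₁.2 z hz]⟩
  have lim : Tendsto F (Bornology.cobounded ℂ) (𝓝 (G 0)) := by
    have h1 : Tendsto (fun ζ : ℂ => G ζ⁻¹) (Bornology.cobounded ℂ) (𝓝 (G 0)) :=
      hG.continuousAt.tendsto.comp tendsto_inv₀_cobounded
    refine h1.congr' ?_
    have h2 : ∀ᶠ ζ : ℂ in Bornology.cobounded ℂ, G ζ⁻¹ = F₁ (ζ⁻¹)⁻¹ :=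
      (tendsto_inv₀_cobounded' (α := ℂ)).eventually hGF
    have h3 : ∀ᶠ ζ : ℂ in Bornology.cobounded ℂ, a ≤ ‖ζ‖ :=
      (tendsto_norm_cobounded_atTop (E := ℂ)).eventually_ge_atTop a
    filter_upwards [h2, h3] with ζ e2 e3
    rw [e2, inv_inv, FF₁]
    by_contra! hc
    have : ζ = ζ.re := Complex.ext rfl (by simp [hc.1])
    rw [this, Complex.norm_real, Real.norm_eq_abs] at e3
    linarith [hc.2]
  have G0 : G 0 = 0 := by
    have h1 : Tendsto (fun y : ℝ => (-(y * I) : ℂ)) atTop (Bornology.cobounded ℂ) := by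
      rw [← tendsto_norm_atTop_iff_cobounded]
      simpa using tendsto_abs_atTop_atTop
    refine tendsto_nhds_unique (lim.comp h1) ((tendsto_carlemanMinus hf).congr' ?_)
    filter_upwards [eventually_gt_atTop (0 : ℝ)] with y hy
    exact (hext.2 _ (by simpa using hy)).symm
  refine ⟨F, max a b, le_max_left _ _, hext, ?_, ?_, G0 ▸ lim⟩
  · refine DifferentiableOn.congr (f := F₁) (fun z hz => ?_) fun z hz => FF₁ z ?_
    · refine (hA₁ z ?_).differentiableAt.differentiableWithinAt
      refine mem_slitCompl.2 ((mem_slitCompl.1 hz).imp id fun h => ?_)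
      exact (le_max_right a b).trans_lt h
    · exact (mem_slitCompl.1 hz).imp id fun h => ((le_max_left a b).trans_lt h).le
  · refine DifferentiableOn.congr (f := F₂) (fun z hz => ?_) fun z hz => FF₂ z hz
    refine (hA₂ z ?_).differentiableAt.differentiableWithinAt
    by_cases h : z.im = 0
    · right
      exact ⟨z.re, abs_lt.1 (hz.resolve_left (by simpa using h)), Complex.ext rfl (by simp [h])⟩
    · exact Or.inl h

/-- A function with bounded spectrum and spectral gap `(-a, a)` is the real part of an entire
function decaying like `exp (-α Im z)` in the upper half-plane, up to `exp (δ |Re z|)`. -/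
theorem exists_entire_of_spectralGap {f : ℝ → ℝ} {a α δ : ℝ} (hf : CarlemanClass f)
    (hbdd : HasBoundedSpectrum f) (hgap : HasSpectralGap f a) (hα : 0 < α) (hαa : α < a)
    (hδ : 0 < δ) :
    ∃ h : ℂ → ℂ, Differentiable ℂ h ∧ (∀ᵐ x : ℝ, f x = (h x).re) ∧
      ∃ C : ℝ, ∀ z : ℂ, 0 ≤ z.im → ‖h z‖ ≤ C * Real.exp (-α * z.im + δ * |z.re|) := by
  obtain ⟨F, M, haM, hext, hFM, hFa, hF0⟩ := exists_carleman_extension hf hbdd hgap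
  set R : ℝ := M + 1 with hR
  have hMR : M < R := by linarith
  have hR0 : 0 < R := by linarith
  have hδn : -δ ≠ 0 := by linarith
  set S : Set ℂ := slitCompl M ∪ {z : ℂ | z.im ≠ 0 ∨ |z.re| < a} with hS
  have hSo : IsOpen {z : ℂ | z.im ≠ 0 ∨ |z.re| < a} :=
    (isOpen_ne_fun Complex.continuous_im continuous_const).union
      (isOpen_lt (continuous_abs.comp Complex.continuous_re) continuous_const)
  have hc : ContinuousOn F S := hFM.continuousOn.union_of_isOpen hFa.continuousOn
    (isOpen_slitCompl M) hSo
  have mem : ∀ x y : ℝ, (y ≠ 0 ∨ |x| < a ∨ M < |x|) → (x + y * I : ℂ) ∈ S := by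
    rintro x y (h | h | h)
    · exact Or.inr (Or.inl (by simpa using h))
    · exact Or.inr (Or.inr (by simpa using h))
    · exact Or.inl (mem_slitCompl.2 (Or.inr (by simpa using h)))
  have mx : ∀ x : ℝ, (x + (-δ : ℝ) * I : ℂ) ∈ S ∧ (x + δ * I : ℂ) ∈ S := fun x =>
    ⟨mem _ _ (Or.inl hδn), mem _ _ (Or.inl hδ.ne')⟩
  have mR : ∀ y : ℝ, (R + y * I : ℂ) ∈ S := fun y =>
    mem _ _ (Or.inr (Or.inr (by rwa [abs_of_pos hR0])))
  have mnR : ∀ y : ℝ, ((-R : ℝ) + y * I : ℂ) ∈ S := fun y =>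
    mem _ _ (Or.inr (Or.inr (by rwa [abs_neg, abs_of_pos hR0])))
  have mα : ∀ y : ℝ, (α + y * I : ℂ) ∈ S := fun y =>
    mem _ _ (Or.inr (Or.inl (by rwa [abs_of_pos hα])))
  have mnα : ∀ y : ℝ, ((-α : ℝ) + y * I : ℂ) ∈ S := fun y =>
    mem _ _ (Or.inr (Or.inl (by rwa [abs_neg, abs_of_pos hα])))
  have sAll : ContinuousOnSides F (-R) R δ := ContinuousOn.continuousOnSides hc (by linarith) hδ.le
    (fun x _ => mx x) (fun y _ => ⟨mnR y, mR y⟩)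
  have sPos : ContinuousOnSides F α R δ := ContinuousOn.continuousOnSides hc (by linarith) hδ.le
    (fun x _ => mx x) (fun y _ => ⟨mα y, mR y⟩)
  have sNeg : ContinuousOnSides F (-R) (-α) δ :=
    ContinuousOn.continuousOnSides hc (by linarith) hδ.le
    (fun x _ => mx x) (fun y _ => ⟨mnR y, mnα y⟩)
  have split : ∀ t : ℂ, rectExp F (-R) R δ t = rectExp F (-R) (-α) δ t + rectExp F α R δ t := by
    intro t
    have hct : ContinuousOn (fun ζ => F ζ * cexp (I * t * ζ)) S := hc.mul (by fun_prop)
    have e1 := rectIntegral_add (x₁ := -R) (x₂ := -α) (x₃ := R) (y₁ := -δ) (y₂ := δ) hct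
      (fun x _ => mx x) (fun x _ => mx x)
    have e2 := rectIntegral_add (x₁ := -α) (x₂ := α) (x₃ := R) (y₁ := -δ) (y₂ := δ) hct
      (fun x _ => mx x) (fun x _ => mx x)
    -- The gap is used here: `F` is holomorphic on the whole middle rectangle.
    have e3 : rectIntegral (fun ζ => F ζ * cexp (I * t * ζ)) (-α) α (-δ) δ = 0 := by
      apply rectIntegral_eq_zero
      refine (hFa.mul (by fun_prop)).mono fun z hz => Or.inr ?_
      have := hz.1
      rw [uIcc_of_le (by linarith)] at this
      exact (abs_le.2 this).trans_lt hαa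
    rw [e3, zero_add] at e2
    rw [rectExp, rectExp, rectExp, e1, e2]
  -- The contour integral has transform `I * (-(2πi F)) = 2πF`, while that of `f` is `-F`.
  set c : ℂ := -(1 / (2 * Real.pi) : ℝ) with hcdef
  have hident : ∀ᵐ t : ℝ, (f t : ℂ) - c * rectExp F (-R) R δ t = 0 := by
    refine LaplacePair.ae_eq_zero (δ := δ) ?_
    have h1 : LaplacePair δ (fun t => (f t : ℂ)) (fun z => -F z) := by
      have := laplacePair_of_extendsCarleman hf hext
      exact ⟨fun z hz => this.1 z (by linarith), fun z hz => this.2 z (by linarith)⟩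
    refine (h1.sub (sAll.laplacePair.const_mul c)).congr_right fun z hz => ?_
    rw [rectIntegral_div_sub hFM hF0 hMR hR0 hδ hz, hcdef]
    have : (Real.pi : ℂ) ≠ 0 := by exact_mod_cast Real.pi_ne_zero
    push_cast
    field_simp
    simp [I_sq]
  obtain ⟨C₁, hC₁, hb₁⟩ := sPos.exists_norm_rectExp_le
  obtain ⟨C₂, hC₂, hb₂⟩ := sNeg.exists_norm_rectExp_le
  -- Positive frequencies decay upwards. Negative ones decay downwards, so they are replaced by
  -- their conjugate reflection, which decays upwards and has the same real part on the real line.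
  refine ⟨fun z => c * rectExp F α R δ z + conj (c * rectExp F (-R) (-α) δ (conj z)), ?_, ?_,
    ‖c‖ * C₁ + ‖c‖ * C₂, ?_⟩
  · have d1 := sPos.differentiable_rectExp.const_mul c
    have d2 := sNeg.differentiable_rectExp.const_mul c
    refine d1.add fun z => ?_
    have := (d2 (conj z)).conj_conj
    rwa [Complex.conj_conj] at this
  · filter_upwards [hident] with x hx
    have : f x = (c * rectExp F (-R) R δ x).re := by
      rw [← sub_eq_zero.1 hx, Complex.ofReal_re]
    rw [this, split, mul_add, add_re, add_re, conj_re, conj_ofReal, add_comm]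
  · intro z hz
    have rb : ∀ u y : ℝ, y ∈ Icc (-δ) δ → -(u * y) ≤ δ * |u| := by
      intro u y hy
      have := abs_mul u y
      have h2 := neg_abs_le (u * y)
      have h3 : |y| ≤ δ := abs_le.2 hy
      nlinarith [abs_nonneg u]
    have b1 := hb₁ z (-α * z.im + δ * |z.re|) fun x hx y hy => by
      have := rb z.re y hy
      have h2 := mul_le_mul_of_nonneg_right hx.1 hz
      simp [mul_re, mul_im]
      linarith
    have b2 := hb₂ (conj z) (-α * z.im + δ * |z.re|) fun x hx y hy => by
      have := rb z.re y hy
      have h2 := mul_le_mul_of_nonneg_right hx.2 hz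
      simp [mul_re, mul_im]
      linarith
    refine (norm_add_le _ _).trans ?_
    rw [RCLike.norm_conj, norm_mul, norm_mul]
    have k1 := mul_le_mul_of_nonneg_left b1 (norm_nonneg c)
    have k2 := mul_le_mul_of_nonneg_left b2 (norm_nonneg c)
    linarith

/-! ### Zeros of entire functions and induction on them. -/

lemma finite_zeros_of_differentiable {h : ℂ → ℂ} (hd : Differentiable ℂ h) (h0 : h ≠ 0)
    {K : Set ℂ} (hK : IsCompact K) : {z ∈ K | h z = 0}.Finite := by
  by_contra hinf
  obtain ⟨x, -, hx⟩ := Set.Infinite.exists_accPt_of_subset_isCompact hinf hK fun z hz => hz.1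
  rw [accPt_iff_frequently_nhdsNE] at hx
  have ha : AnalyticOnNhd ℂ h univ := fun z _ => hd.analyticAt z
  refine h0 (ha.eq_of_frequently_eq (g := 0) (fun _ _ => analyticAt_const) (hx.mono ?_))
  exact fun z hz => hz.2

lemma ae_circleMap_ne_zero {h : ℂ → ℂ} (hd : Differentiable ℂ h) (h0 : h ≠ 0) {ρ : ℝ}
    (hρ : 0 < ρ) : ∀ᵐ θ : ℝ, h (circleMap 0 ρ θ) ≠ 0 := by
  have hfin := finite_zeros_of_differentiable hd h0 (isCompact_closedBall (0 : ℂ) ρ)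
  have hc := (hfin.countable.preimage_circleMap 0 hρ.ne').ae_notMem volume
  filter_upwards [hc] with θ hθ hz
  exact hθ ⟨by simp [abs_of_pos hρ], hz⟩

/-- The order at `z₀` is finite by the identity theorem, and iterating `dslope` divides out the zero
without leaving the entire functions. -/
lemma exists_eq_pow_mul_of_differentiable {h : ℂ → ℂ} (hd : Differentiable ℂ h) (h0 : h ≠ 0)
    (z₀ : ℂ) : ∃ (n : ℕ) (g : ℂ → ℂ), Differentiable ℂ g ∧ g z₀ ≠ 0 ∧
      ∀ z, h z = (z - z₀) ^ n * g z := by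
  obtain ⟨p, hp⟩ := hd.analyticAt z₀
  have hp0 : p ≠ 0 := by
    rintro rfl
    have h1 : h =ᶠ[𝓝 z₀] 0 := hp.eventually_eq_zero
    exact h0 (AnalyticOnNhd.eq_of_eventuallyEq (fun z _ => hd.analyticAt z)
      (fun _ _ => analyticAt_const) h1)
  refine ⟨p.order, (Function.swap dslope z₀)^[p.order] h, ?_,
    hp.iterate_dslope_fslope_ne_zero hp0, fun z => hp.eq_pow_order_mul_iterate_dslope z⟩
  have step : ∀ n, Differentiable ℂ ((Function.swap dslope z₀)^[n] h) := by
    intro n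
    induction n with
    | zero => exact hd
    | succ n ih =>
      rw [Function.iterate_succ_apply', ← differentiableOn_univ]
      exact (Complex.differentiableOn_dslope univ_mem).2 ih.differentiableOn
  exact step _

/-- Induction along the zeros of an entire function in a compact set. -/
lemma entire_induction {K : Set ℂ} (hK : IsCompact K) {P : (ℂ → ℂ) → Prop} {Q : ℂ → Prop}
    (hmul : ∀ f g, P f → P g → P (fun z => f z * g z))
    (hlin : ∀ z₀, Q z₀ → P (fun z => z - z₀))
    (hnz : ∀ g, Differentiable ℂ g → (∀ z ∈ K, g z ≠ 0) → P g)
    {h : ℂ → ℂ} (hd : Differentiable ℂ h) (h0 : h ≠ 0) (hQ : ∀ z ∈ K, h z = 0 → Q z) : P h := by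
  -- Distinct zeros are counted: dividing out one zero with its full multiplicity lowers the count.
  induction hn : {z ∈ K | h z = 0}.ncard using Nat.strong_induction_on generalizing h with
  | _ N ih =>
    by_cases hz : ∃ z₀ ∈ K, h z₀ = 0
    · obtain ⟨z₀, hz₀K, hz₀⟩ := hz
      obtain ⟨n, g, hg, hgz, e⟩ := exists_eq_pow_mul_of_differentiable hd h0 z₀
      have hg0 : g ≠ 0 := fun hg0 => hgz (by rw [hg0]; rfl)
      have zs : ∀ z, g z = 0 → h z = 0 := fun z hz => by rw [e, hz, mul_zero]
      have hP : P g := by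
        refine ih _ ?_ hg hg0 (fun z hzK hz => hQ z hzK (zs z hz)) rfl
        rw [← hn]
        refine Set.ncard_lt_ncard ⟨fun z hz => ⟨hz.1, zs z hz.2⟩, fun hsub => ?_⟩
          (finite_zeros_of_differentiable hd h0 hK)
        exact hgz (hsub ⟨hz₀K, hz₀⟩).2
      have hpow : ∀ m : ℕ, P (fun z => (z - z₀) ^ m * g z) := by
        intro m
        induction m with
        | zero => simpa using hP
        | succ m ihm =>
          have := hmul _ _ (hlin z₀ (hQ z₀ hz₀K hz₀)) ihm
          simpa only [pow_succ', mul_assoc] using this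
      rw [funext e]
      exact hpow n
    · push Not at hz
      exact hnz h hd hz

/-! ### Jensen's inequality in a half disc. -/

/-- The integral of `log |h|` over the upper half of the circle `|z| = ρ`. -/
def arcLog (h : ℂ → ℂ) (ρ : ℝ) : ℝ :=
  ∫ θ in (0 : ℝ)..Real.pi, Real.log ‖h (circleMap 0 ρ θ)‖

lemma intervalIntegrable_arcLog {h : ℂ → ℂ} (hd : Differentiable ℂ h) (ρ : ℝ) {p q : ℝ}
    (hp : p ∈ Icc 0 (2 * Real.pi)) (hq : q ∈ Icc 0 (2 * Real.pi)) :
    IntervalIntegrable (fun θ => Real.log ‖h (circleMap 0 ρ θ)‖) volume p q := by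
  have h1 : CircleIntegrable (fun z => Real.log ‖h z‖) 0 ρ :=
    MeromorphicOn.circleIntegrable_log_norm fun z _ => (hd.analyticAt z).meromorphicAt
  have h2 : IntervalIntegrable (fun θ => Real.log ‖h (circleMap 0 ρ θ)‖) volume 0 (2 * Real.pi) := h1
  refine h2.mono_set ?_
  rw [uIcc_of_le (by positivity : (0 : ℝ) ≤ 2 * Real.pi)]
  exact uIcc_subset_Icc hp hq

lemma pi_mem_Icc : Real.pi ∈ Icc 0 (2 * Real.pi) :=
  ⟨Real.pi_pos.le, by linarith [Real.pi_pos]⟩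

lemma zero_mem_Icc_two_pi : (0 : ℝ) ∈ Icc 0 (2 * Real.pi) := ⟨le_rfl, by positivity⟩

lemma arcLog_mul {f g : ℂ → ℂ} (hf : Differentiable ℂ f) (hg : Differentiable ℂ g)
    (hf0 : f ≠ 0) (hg0 : g ≠ 0) {ρ : ℝ} (hρ : 0 < ρ) :
    arcLog (fun z => f z * g z) ρ = arcLog f ρ + arcLog g ρ := by
  unfold arcLog
  rw [← intervalIntegral.integral_add
    (intervalIntegrable_arcLog hf ρ zero_mem_Icc_two_pi pi_mem_Icc)
    (intervalIntegrable_arcLog hg ρ zero_mem_Icc_two_pi pi_mem_Icc)]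
  refine intervalIntegral.integral_congr_ae ?_
  filter_upwards [ae_circleMap_ne_zero hf hf0 hρ, ae_circleMap_ne_zero hg hg0 hρ] with θ h1 h2 _
  rw [norm_mul, Real.log_mul (norm_ne_zero_iff.2 h1) (norm_ne_zero_iff.2 h2)]

/-- Cauchy's theorem for `L z / z` in the half annulus `r₀ ≤ |z| ≤ r`, `0 ≤ Im z`. -/
lemma integral_im_sub_eq {L : ℂ → ℂ} {r₀ r : ℝ} (hr₀ : 0 < r₀) (hr : r₀ ≤ r)
    (hL : ∀ z : ℂ, 0 ≤ z.im → ‖z‖ ≤ r → DifferentiableAt ℂ L z) :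
    ∫ s in (Real.log r₀)..(Real.log r), ((L (Real.exp s : ℝ)).im - (L (-(Real.exp s : ℝ) : ℝ)).im) =
      -((∫ θ in (0 : ℝ)..Real.pi, (L (circleMap 0 r θ)).re) -
        ∫ θ in (0 : ℝ)..Real.pi, (L (circleMap 0 r₀ θ)).re) := by
  have hr' : 0 < r := hr₀.trans_le hr
  have hlog : Real.log r₀ ≤ Real.log r := Real.log_le_log hr₀ hr
  -- In the coordinate `z = exp ζ` the half annulus is a rectangle and `dz / z` becomes `dζ`; the
  -- claim is the imaginary part of Cauchy's theorem there.
  have hd : DifferentiableOn ℂ (fun ζ => L (cexp ζ))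
      ([[Real.log r₀, Real.log r]] ×ℂ [[0, Real.pi]]) := by
    intro ζ hζ
    obtain ⟨h1, h2⟩ := hζ
    rw [mem_preimage, uIcc_of_le hlog] at h1
    rw [mem_preimage, uIcc_of_le Real.pi_pos.le] at h2
    refine ((hL _ ?_ ?_).comp ζ Complex.differentiableAt_exp).differentiableWithinAt
    · rw [Complex.exp_im]
      exact mul_nonneg (Real.exp_pos _).le (Real.sin_nonneg_of_mem_Icc h2)
    · rw [Complex.norm_exp, ← Real.exp_log hr']
      exact Real.exp_le_exp.2 h1.2
  have hz := rectIntegral_eq_zero hd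
  have m0 : (0 : ℝ) ∈ [[0, Real.pi]] := left_mem_uIcc
  have mπ : Real.pi ∈ [[0, Real.pi]] := right_mem_uIcc
  have i1 := (continuousOn_horizontal (y := 0) hd.continuousOn fun x hx =>
    ⟨by simpa using hx, by simp⟩).intervalIntegrable (μ := volume)
  have i2 := (continuousOn_horizontal (y := Real.pi) hd.continuousOn fun x hx =>
    ⟨by simpa using hx, by simp⟩).intervalIntegrable (μ := volume)
  have i3 := (continuousOn_vertical (x := Real.log r) hd.continuousOn fun y hy =>
    ⟨by simp, by simpa using hy⟩).intervalIntegrable (μ := volume)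
  have i4 := (continuousOn_vertical (x := Real.log r₀) hd.continuousOn fun y hy =>
    ⟨by simp, by simpa using hy⟩).intervalIntegrable (μ := volume)
  have c1 := Complex.imCLM.intervalIntegral_comp_comm i1
  have c2 := Complex.imCLM.intervalIntegral_comp_comm i2
  have c3 := Complex.reCLM.intervalIntegral_comp_comm i3
  have c4 := Complex.reCLM.intervalIntegral_comp_comm i4
  have him := congrArg Complex.im hz
  simp only [rectIntegral, sub_im, add_im, I_mul_im, zero_im] at him
  simp only [imCLM_apply, reCLM_apply] at c1 c2 c3 c4
  rw [← c1, ← c2, ← c3, ← c4] at him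
  have e1 : ∀ s : ℝ, cexp (s + (0 : ℝ) * I) = ((Real.exp s : ℝ) : ℂ) := fun s => by simp
  have e2 : ∀ s : ℝ, cexp (s + Real.pi * I) = ((-Real.exp s : ℝ) : ℂ) := fun s => by
    rw [Complex.exp_add, Complex.exp_pi_mul_I]; simp
  have e3 : ∀ ρ : ℝ, 0 < ρ → ∀ θ : ℝ, cexp (Real.log ρ + θ * I) = circleMap 0 ρ θ := by
    intro ρ hρ θ
    rw [Complex.exp_add, ← Complex.ofReal_exp, Real.exp_log hρ, circleMap, zero_add]
  simp only [e1, e2, e3 r hr', e3 r₀ hr₀] at him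
  have j1 : IntervalIntegrable (fun s : ℝ => (L (Real.exp s : ℝ)).im) volume
      (Real.log r₀) (Real.log r) := by
    have := Complex.imCLM.integrable_comp i1.1
    have h2 := Complex.imCLM.integrable_comp i1.2
    simp only [e1, imCLM_apply] at this h2
    exact ⟨this, h2⟩
  have j2 : IntervalIntegrable (fun s : ℝ => (L (-(Real.exp s : ℝ) : ℝ)).im) volume
      (Real.log r₀) (Real.log r) := by
    have := Complex.imCLM.integrable_comp i2.1
    have h2 := Complex.imCLM.integrable_comp i2.2
    simp only [e2, imCLM_apply] at this h2
    exact ⟨this, h2⟩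
  rw [intervalIntegral.integral_sub j1 j2]
  linarith

/-- `h` has a continuous phase along `[-r, r]` whose oscillation dominates the decrease of
`∫ log |h|` over half circles, as in Jensen's formula. -/
structure PhaseJensen (r₀ r : ℝ) (h : ℂ → ℂ) : Prop where
  diff : Differentiable ℂ h
  ne_zero : h ≠ 0
  phase : ∃ φ : ℝ → ℝ, ContinuousOn φ (Icc (-r) r) ∧
    (∀ x ∈ Icc (-r) r, h x = ‖h x‖ * cexp (φ x * I)) ∧
    -(arcLog h r - arcLog h r₀) ≤
      ∫ s in (Real.log r₀)..(Real.log r), (φ (Real.exp s) - φ (-Real.exp s))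

lemma intervalIntegrable_phase {r₀ r : ℝ} (hr₀ : 0 < r₀) (hr : r₀ ≤ r) {φ : ℝ → ℝ}
    (hφ : ContinuousOn φ (Icc (-r) r)) :
    IntervalIntegrable (fun s => φ (Real.exp s) - φ (-Real.exp s)) volume
      (Real.log r₀) (Real.log r) := by
  have hr' : 0 < r := hr₀.trans_le hr
  have key : ∀ s ∈ [[Real.log r₀, Real.log r]], 0 < Real.exp s ∧ Real.exp s ≤ r := by
    intro s hs
    rw [uIcc_of_le (Real.log_le_log hr₀ hr)] at hs
    refine ⟨Real.exp_pos _, ?_⟩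
    rw [← Real.exp_log hr']
    exact Real.exp_le_exp.2 hs.2
  apply ContinuousOn.intervalIntegrable
  refine (hφ.comp Real.continuous_exp.continuousOn fun s hs => ?_).sub
    (hφ.comp Real.continuous_exp.neg.continuousOn fun s hs => ?_)
  · exact ⟨by linarith [(key s hs).1], (key s hs).2⟩
  · exact ⟨by linarith [(key s hs).2], by linarith [(key s hs).1]⟩

lemma PhaseJensen.mul {r₀ r : ℝ} (hr₀ : 0 < r₀) (hr : r₀ ≤ r) {f g : ℂ → ℂ}
    (hf : PhaseJensen r₀ r f) (hg : PhaseJensen r₀ r g) :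
    PhaseJensen r₀ r (fun z => f z * g z) := by
  obtain ⟨φ, hφ, eφ, iφ⟩ := hf.phase
  obtain ⟨ψ, hψ, eψ, iψ⟩ := hg.phase
  refine ⟨hf.diff.mul hg.diff, fun h => ?_, fun x => φ x + ψ x, hφ.add hψ, fun x hx => ?_, ?_⟩
  · obtain ⟨θ, h1, h2⟩ := ((ae_circleMap_ne_zero hf.diff hf.ne_zero hr₀).and
      (ae_circleMap_ne_zero hg.diff hg.ne_zero hr₀)).exists
    exact mul_ne_zero h1 h2 (congrFun h _)
  · rw [norm_mul]
    conv_lhs => rw [eφ x hx, eψ x hx]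
    push_cast
    rw [add_mul, Complex.exp_add]
    ring
  · rw [arcLog_mul hf.diff hg.diff hf.ne_zero hg.ne_zero (hr₀.trans_le hr),
      arcLog_mul hf.diff hg.diff hf.ne_zero hg.ne_zero hr₀]
    have := intervalIntegral.integral_add (intervalIntegrable_phase hr₀ hr hφ)
      (intervalIntegrable_phase hr₀ hr hψ)
    calc _ ≤ _ := add_le_add iφ iψ
      |>.trans' (by linarith)
      _ = _ := this.symm
      _ = _ := by congr 1 with s; ring

/-- The phase inequality is an equality for a function with an analytic logarithm in the upper
half disc. -/
lemma exists_phase_of_log {r₀ r : ℝ} (hr₀ : 0 < r₀) (hr : r₀ ≤ r) {h L : ℂ → ℂ}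
    (hL : ∀ z : ℂ, 0 ≤ z.im → ‖z‖ ≤ r → DifferentiableAt ℂ L z)
    (hexp : ∀ z : ℂ, 0 ≤ z.im → ‖z‖ ≤ r → h z = cexp (L z)) :
    ∃ φ : ℝ → ℝ, ContinuousOn φ (Icc (-r) r) ∧
      (∀ x ∈ Icc (-r) r, h x = ‖h x‖ * cexp (φ x * I)) ∧
      ∫ s in (Real.log r₀)..(Real.log r), (φ (Real.exp s) - φ (-Real.exp s)) =
        -(arcLog h r - arcLog h r₀) := by
  have hr' : 0 < r := hr₀.trans_le hr
  have arc : ∀ ρ : ℝ, 0 < ρ → ρ ≤ r →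
      arcLog h ρ = ∫ θ in (0 : ℝ)..Real.pi, (L (circleMap 0 ρ θ)).re := by
    intro ρ hρ hρr
    refine intervalIntegral.integral_congr fun θ hθ => ?_
    rw [uIcc_of_le Real.pi_pos.le] at hθ
    rw [hexp _ _ _, Complex.norm_exp, Real.log_exp]
    · rw [circleMap_zero, im_ofReal_mul, exp_ofReal_mul_I_im]
      exact mul_nonneg hρ.le (Real.sin_nonneg_of_mem_Icc hθ)
    · simpa [abs_of_pos hρ] using hρr
  have real : ∀ x ∈ Icc (-r) r, 0 ≤ (x : ℂ).im ∧ ‖(x : ℂ)‖ ≤ r := fun x hx =>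
    ⟨by simp, by simpa using abs_le.2 hx⟩
  refine ⟨fun x => (L x).im, fun x hx => ?_, fun x hx => ?_, ?_⟩
  · have h1 : ContinuousAt L (x : ℂ) := (hL x (real x hx).1 (real x hx).2).continuousAt
    have h2 : ContinuousAt (fun y : ℝ => L y) x :=
      ContinuousAt.comp (f := fun y : ℝ => (y : ℂ)) h1 Complex.continuous_ofReal.continuousAt
    exact (Complex.continuous_im.continuousAt.comp h2).continuousWithinAt
  · rw [hexp x (real x hx).1 (real x hx).2, Complex.norm_exp, Complex.ofReal_exp,
      ← Complex.exp_add, re_add_im]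
  · rw [arc r hr' le_rfl, arc r₀ hr₀ hr, ← integral_im_sub_eq hr₀ hr hL]

/-- With the zero in the lower half-plane, `z - z₀` stays in the open upper half-plane, where the
principal logarithm is analytic. -/
lemma exists_phase_sub_of_im_neg {r₀ r : ℝ} (hr₀ : 0 < r₀) (hr : r₀ ≤ r) {z₀ : ℂ}
    (hz : z₀.im < 0) : ∃ φ : ℝ → ℝ, ContinuousOn φ (Icc (-r) r) ∧
      (∀ x ∈ Icc (-r) r, (x : ℂ) - z₀ = ‖(x : ℂ) - z₀‖ * cexp (φ x * I)) ∧
      ∫ s in (Real.log r₀)..(Real.log r), (φ (Real.exp s) - φ (-Real.exp s)) =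
        -(arcLog (fun z => z - z₀) r - arcLog (fun z => z - z₀) r₀) := by
  have slit : ∀ z : ℂ, 0 ≤ z.im → z - z₀ ∈ slitPlane := fun z hz' =>
    Or.inr (by rw [sub_im]; linarith)
  exact exists_phase_of_log (h := fun z => z - z₀) (L := fun z => Complex.log (z - z₀)) hr₀ hr
    (fun z h _ => DifferentiableAt.clog (by fun_prop) (slit z h))
    fun z h _ => (Complex.exp_log (slitPlane_ne_zero (slit z h))).symm

/-- Reflection carries the upper arc seen from `conj z₀` to the lower arc seen from `z₀`, so the sum
is a full-circle integral. -/
lemma arcLog_add_arcLog_conj (z₀ : ℂ) {ρ : ℝ} (hρ : 0 < ρ) :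
    arcLog (fun z => z - z₀) ρ + arcLog (fun z => z - conj z₀) ρ =
      2 * Real.pi * (Real.log ρ + Real.posLog (ρ⁻¹ * ‖z₀‖)) := by
  have hd : Differentiable ℂ (fun z : ℂ => z - z₀) := by fun_prop
  have h := circleAverage_log_norm_sub_const_eq_log_radius_add_posLog (a := z₀) (c := 0) hρ.ne'
  rw [Real.circleAverage_def, zero_sub, norm_neg, smul_eq_mul,
    inv_mul_eq_iff_eq_mul₀ (by positivity)] at h
  rw [← h, ← intervalIntegral.integral_add_adjacent_intervals
    (intervalIntegrable_arcLog hd ρ zero_mem_Icc_two_pi pi_mem_Icc)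
    (intervalIntegrable_arcLog hd ρ pi_mem_Icc ⟨by positivity, le_rfl⟩)]
  unfold arcLog
  congr 1
  have e : ∀ θ : ℝ, ‖circleMap 0 ρ θ - conj z₀‖ = ‖circleMap 0 ρ (2 * Real.pi - θ) - z₀‖ := by
    intro θ
    rw [← RCLike.norm_conj (circleMap 0 ρ θ - conj z₀), map_sub, Complex.conj_conj]
    congr 2
    rw [circleMap_zero, circleMap_zero, map_mul, conj_ofReal, ← Complex.exp_conj]
    congr 1
    rw [Complex.exp_eq_exp_iff_exists_int]
    refine ⟨-1, ?_⟩
    simp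
    ring
  simp_rw [e]
  rw [intervalIntegral.integral_comp_sub_left
    (fun θ => Real.log ‖circleMap 0 ρ θ - z₀‖) (2 * Real.pi)]
  congr 1 <;> ring

/-- Both sides have the form `max (log ρ) (log c)`. -/
lemma log_add_posLog_mono {r₀ r c : ℝ} (hr₀ : 0 < r₀) (hr : r₀ ≤ r) (hc : 0 < c) :
    Real.log r₀ + Real.posLog (r₀⁻¹ * c) ≤ Real.log r + Real.posLog (r⁻¹ * c) := by
  have e : ∀ ρ : ℝ, 0 < ρ →
      Real.log ρ + Real.posLog (ρ⁻¹ * c) = max (Real.log ρ) (Real.log c) := by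
    intro ρ hρ
    change _ + max 0 (Real.log (ρ⁻¹ * c)) = _
    rw [Real.log_mul (by positivity) hc.ne', Real.log_inv,
      ← max_add_add_left, add_zero, add_neg_cancel_left]
  rw [e r₀ hr₀, e r (hr₀.trans_le hr)]
  exact max_le_max_right _ (Real.log_le_log hr₀ hr)

/-- Zeros in the upper half-plane are the only source of inequality. Such a factor has the opposite
phase to its conjugate factor, and the discrepancy is the growth of a full-circle logarithmic mean,
which is nonnegative. -/
lemma phaseJensen_sub {r₀ r : ℝ} (hr₀ : 0 < r₀) (hr : r₀ ≤ r) {z₀ : ℂ} (hz : z₀.im ≠ 0) :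
    PhaseJensen r₀ r (fun z => z - z₀) := by
  have h0 : (fun z : ℂ => z - z₀) ≠ 0 := fun h => by simpa using congrFun h (z₀ + 1)
  rcases lt_or_gt_of_ne hz with hz | hz
  · obtain ⟨φ, hφ, eφ, iφ⟩ := exists_phase_sub_of_im_neg hr₀ hr hz
    exact ⟨by fun_prop, h0, φ, hφ, eφ, iφ.ge⟩
  · obtain ⟨ψ, hψ, eψ, iψ⟩ :=
      exists_phase_sub_of_im_neg (z₀ := conj z₀) hr₀ hr (by simpa using hz)
    refine ⟨by fun_prop, h0, fun x => -ψ x, hψ.neg, fun x hx => ?_, ?_⟩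
    · have := congrArg conj (eψ x hx)
      rw [map_sub, conj_conj, conj_ofReal, map_mul, conj_ofReal, ← Complex.exp_conj, map_mul,
        conj_ofReal, conj_I] at this
      have e : ‖(x : ℂ) - conj z₀‖ = ‖(x : ℂ) - z₀‖ := by
        rw [← RCLike.norm_conj, map_sub, conj_conj, conj_ofReal]
      rw [e] at this
      rw [ofReal_neg, neg_mul, ← mul_neg]
      exact this
    · have e1 := arcLog_add_arcLog_conj z₀ (hr₀.trans_le hr)
      have e2 := arcLog_add_arcLog_conj z₀ hr₀
      have hc : 0 < ‖z₀‖ := norm_pos_iff.2 fun h => by simp [h] at hz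
      have mono := mul_le_mul_of_nonneg_left (log_add_posLog_mono hr₀ hr hc)
        (by positivity : 0 ≤ 2 * Real.pi)
      have : ∀ s : ℝ, -ψ (Real.exp s) - -ψ (-Real.exp s) =
          -(ψ (Real.exp s) - ψ (-Real.exp s)) := fun s => by ring
      simp_rw [this]
      rw [intervalIntegral.integral_neg, iψ]
      linarith

/-- A primitive of `g' / g` on the disc, normalised at the centre, makes `g * exp (-L)` constant. -/
lemma exists_log_of_ne_zero {g : ℂ → ℂ} {R : ℝ} (hg : Differentiable ℂ g) (hR : 0 < R)
    (h : ∀ z ∈ Metric.ball (0 : ℂ) R, g z ≠ 0) :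
    ∃ L : ℂ → ℂ, ∀ z ∈ Metric.ball (0 : ℂ) R, DifferentiableAt ℂ L z ∧ g z = cexp (L z) := by
  have hd : DifferentiableOn ℂ (fun z => deriv g z / g z) (Metric.ball (0 : ℂ) R) :=
    ((hg.deriv).differentiableOn).div hg.differentiableOn h
  obtain ⟨L, hL0, hL⟩ := (hd.isExactOn_ball).with_val_at 0 (Complex.log (g 0))
  have h0 : (0 : ℂ) ∈ Metric.ball (0 : ℂ) R := Metric.mem_ball_self hR
  have hder : ∀ z ∈ Metric.ball (0 : ℂ) R, HasDerivAt (fun z => g z * cexp (-L z)) 0 z := by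
    intro z hz
    have := (hg z).hasDerivAt.mul ((hL z hz).neg.cexp)
    refine this.congr_deriv ?_
    have := h z hz
    field_simp
    ring
  refine ⟨L, fun z hz => ⟨(hL z hz).differentiableAt, ?_⟩⟩
  have hconst := (convex_ball (0 : ℂ) R).is_const_of_fderivWithin_eq_zero (𝕜 := ℂ)
    (f := fun z => g z * cexp (-L z))
    (fun w hw => (hder w hw).differentiableAt.differentiableWithinAt)
    (fun w hw => by
      rw [fderivWithin_of_isOpen Metric.isOpen_ball hw]
      ext
      simp [(hder w hw).deriv]) hz h0
  rw [hL0, Complex.exp_neg, Complex.exp_neg, Complex.exp_log (h 0 h0), mul_inv_cancel₀ (h 0 h0)]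
    at hconst
  rwa [mul_inv_eq_one₀ (Complex.exp_ne_zero _)] at hconst

/-- Jensen's formula in the half disc for an entire function without zeros on `[-r, r]`. -/
theorem phaseJensen_of_real_ne_zero {r₀ r : ℝ} (hr₀ : 0 < r₀) (hr : r₀ ≤ r) {h : ℂ → ℂ}
    (hd : Differentiable ℂ h) (hne : ∀ x ∈ Icc (-r) r, h (x : ℝ) ≠ 0) : PhaseJensen r₀ r h := by
  have hr' : 0 < r := hr₀.trans_le hr
  refine entire_induction (isCompact_closedBall (0 : ℂ) r) (Q := fun z => z.im ≠ 0)
    (fun f g hf hg => hf.mul hr₀ hr hg) (fun z₀ hz => phaseJensen_sub hr₀ hr hz)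
    (fun g hg hgne => ?_) hd (fun h0 => ?_) fun z hz hz0 him => ?_
  -- Compactness gives a slightly larger open disc without zeros, so the logarithm is differentiable
  -- up to the boundary circle.
  · obtain ⟨η, hη, hsub⟩ := (isCompact_closedBall (0 : ℂ) r).exists_thickening_subset_open
      (isOpen_ne_fun hg.continuous continuous_const) hgne
    rw [thickening_closedBall hη hr'.le] at hsub
    obtain ⟨L, hL⟩ := exists_log_of_ne_zero hg (by linarith) hsub
    have inb : ∀ z : ℂ, ‖z‖ ≤ r → z ∈ Metric.ball (0 : ℂ) (η + r) := fun z hz => by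
      simpa using by linarith
    obtain ⟨φ, hφ, eφ, iφ⟩ := exists_phase_of_log (h := g) (L := L) hr₀ hr
      (fun z _ hz => (hL z (inb z hz)).1) fun z _ hz => (hL z (inb z hz)).2
    exact ⟨hg, fun h0 => hgne 0 (by simp [hr'.le]) (by rw [h0]; rfl), φ, hφ, eφ, iφ.ge⟩
  · exact hne 0 ⟨by linarith, hr'.le⟩ (by rw [h0]; rfl)
  · have e : z = (z.re : ℂ) := Complex.ext rfl (by simp [him])
    rw [e] at hz0 hz
    exact hne z.re (abs_le.1 (by simpa using hz)) hz0

/-! ### Sign changes: from below by the phase, from above by zeros. -/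

/-- Two candidate shifts `d` and `2d` suffice: the cosine cannot vanish at both, since `sin d ≠ 0`.
-/
lemma exists_cos_ne_zero {u m : ℝ} (hm : 0 < m) : ∃ c, 0 < c ∧ c < m ∧ Real.cos (u + c) ≠ 0 := by
  set d := min m 1 / 4 with hd
  have hd0 : 0 < d := by positivity
  have hd1 : d ≤ 1 / 4 := by rw [hd]; linarith [min_le_right m 1]
  have hdm : 2 * d < m := by
    have := min_le_left m 1
    rw [hd]; linarith
  by_cases h : Real.cos (u + d) = 0
  · refine ⟨2 * d, by linarith, hdm, fun h2 => ?_⟩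
    have hs : Real.sin d = 0 := by
      have e : Real.cos (u + 2 * d) = Real.cos (u + d) * Real.cos d - Real.sin (u + d) * Real.sin d := by
        rw [← Real.cos_add]; ring_nf
      rw [h2, h, zero_mul, zero_sub, eq_comm, neg_eq_zero] at e
      refine (mul_eq_zero.1 e).resolve_left fun h3 => ?_
      have := Real.sin_sq_add_cos_sq (u + d)
      rw [h, h3] at this
      norm_num at this
    exact (Real.sin_pos_of_pos_of_lt_pi hd0 (by linarith [Real.pi_gt_three])).ne' hs
  · exact ⟨d, hd0, by linarith, h⟩

/-- A continuous function equal to `N cos φ`, `N > 0`, changes sign at least `n + 1` times on an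
interval where the phase `φ` increases by more than `(n + 1) π`. -/
lemma changesSign_of_phase_lt {f H N φ : ℝ → ℝ} (hfH : f =ᵐ[volume] H) (hH : Continuous H)
    {p q : ℝ} (hpq : p ≤ q) (hφ : ContinuousOn φ (Icc p q)) (hN : ∀ x ∈ Icc p q, 0 < N x)
    (hHN : ∀ x ∈ Icc p q, H x = N x * Real.cos (φ x)) {n : ℕ}
    (hlt : Real.pi * n < φ q - φ p) : ChangesSign f (Icc p q) n := by
  obtain ⟨c, hc0, hc1, hcos⟩ := exists_cos_ne_zero (u := φ p) (sub_pos.2 hlt)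
  -- A phase increase above `nπ` leaves room for `n + 1` levels spaced by `π`, hence `n + 1` points
  -- and `n` changes; `c` keeps the cosine nonzero on them.
  set θ : ℕ → ℝ := fun i => φ p + c + i * Real.pi with hθ
  have θmono : StrictMono θ := fun i j hij => by
    have : (i : ℝ) < j := by exact_mod_cast hij
    have := mul_lt_mul_of_pos_right this Real.pi_pos
    simp only [hθ]; linarith
  have θlow : ∀ i, φ p < θ i := fun i => by
    have : (0 : ℝ) ≤ i * Real.pi := by positivity
    simp only [hθ]; linarith
  have θup : ∀ i, i ≤ n → θ i < φ q := fun i hi => by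
    have : (i : ℝ) ≤ n := by exact_mod_cast hi
    have := mul_le_mul_of_nonneg_right this Real.pi_pos.le
    simp only [hθ]; linarith
  -- First hitting points are chosen because they come in the order of the levels, by the
  -- intermediate value theorem, even if the phase is not monotone.
  have ex : ∀ i : Fin (n + 1), ∃ x, IsLeast {x ∈ Icc p q | φ x = θ i} x := by
    intro i
    have hcl : IsClosed {x ∈ Icc p q | φ x = θ i} :=
      hφ.preimage_isClosed_of_isClosed isClosed_Icc (isClosed_singleton (x := θ i))
    refine (isCompact_Icc.of_isClosed_subset hcl fun x hx => hx.1).exists_isLeast ?_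
    obtain ⟨x, hx, e⟩ := intermediate_value_Icc hpq hφ
      ⟨(θlow i).le, (θup i (Nat.lt_succ_iff.1 i.2)).le⟩
    exact ⟨x, hx, e⟩
  choose x hx using ex
  have hxI : ∀ i, x i ∈ Ioo p q := by
    intro i
    obtain ⟨h1, h2⟩ := (hx i).1
    refine ⟨lt_of_le_of_ne h1.1 ?_, lt_of_le_of_ne h1.2 ?_⟩
    · rintro e; rw [← e] at h2; exact (θlow i).ne h2
    · rintro e; rw [e] at h2; exact (θup i (Nat.lt_succ_iff.1 i.2)).ne' h2
  refine ⟨if 0 < Real.cos (φ p + c) then 1 else -1, by split_ifs <;> simp, x, ?_, fun i =>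
    ⟨Ioo_subset_Icc_self (hxI i), fun δ hδ => ?_⟩⟩
  · intro i j hij
    have hθij : θ i < θ j := θmono hij
    obtain ⟨y, hy, e⟩ := intermediate_value_Icc (hxI j).1.le
      (hφ.mono (Icc_subset_Icc_right (hxI j).2.le))
      (⟨(θlow i).le, by rw [(hx j).1.2]; exact hθij.le⟩ : θ i ∈ Icc (φ p) (φ (x j)))
    have hle : x i ≤ y := (hx i).2 ⟨⟨hy.1, hy.2.trans (hxI j).2.le⟩, e⟩
    refine hle.trans_lt (lt_of_le_of_ne hy.2 ?_)
    rintro rfl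
    rw [(hx j).1.2] at e
    exact hθij.ne' e
  · set ε : ℝ := if 0 < Real.cos (φ p + c) then 1 else -1 with hε
    have hεpos : 0 < ε * Real.cos (φ p + c) := by
      rw [hε]
      split_ifs with h
      · simpa using h
      · have := lt_of_le_of_ne (not_lt.1 h) hcos
        linarith
    have hHx : 0 < ε * (-1) ^ (i : ℕ) * H (x i) := by
      rw [hHN _ (Ioo_subset_Icc_self (hxI i)), (hx i).1.2, hθ]
      dsimp only
      rw [Real.cos_add_nat_mul_pi]
      have h1 : ((-1 : ℝ) ^ (i : ℕ)) * (-1) ^ (i : ℕ) = 1 := by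
        rw [← mul_pow]; simp
      have h2 := hN _ (Ioo_subset_Icc_self (hxI i))
      calc (0 : ℝ) < N (x i) * (ε * Real.cos (φ p + c)) := mul_pos h2 hεpos
        _ = N (x i) * (ε * Real.cos (φ p + c)) * (((-1 : ℝ) ^ (i : ℕ)) * (-1) ^ (i : ℕ)) := by
          rw [h1, mul_one]
        _ = _ := by ring
    have hopen : IsOpen (Ioo p q ∩ Metric.ball (x i) δ ∩ {y | 0 < ε * (-1) ^ (i : ℕ) * H y}) :=
      (isOpen_Ioo.inter Metric.isOpen_ball).inter (isOpen_lt continuous_const (by fun_prop))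
    have hpos := hopen.measure_pos volume ⟨x i, ⟨hxI i, Metric.mem_ball_self hδ⟩, hHx⟩
    refine hpos.trans_le (measure_mono_ae ?_)
    filter_upwards [hfH] with y hy hmem
    obtain ⟨⟨h1, h2⟩, h3⟩ := hmem
    refine ⟨Ioo_subset_Icc_self h1, by rwa [Metric.mem_ball, Real.dist_eq] at h2, ?_⟩
    rw [hy]
    exact h3

lemma changesSign_of_phase {f H N φ : ℝ → ℝ} (hfH : f =ᵐ[volume] H) (hH : Continuous H)
    {p q : ℝ} (hφ : ContinuousOn φ [[p, q]]) (hN : ∀ x ∈ [[p, q]], 0 < N x)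
    (hHN : ∀ x ∈ [[p, q]], H x = N x * Real.cos (φ x)) {n : ℕ}
    (hlt : Real.pi * n < |φ q - φ p|) : ChangesSign f [[p, q]] n := by
  wlog hpq : p ≤ q generalizing p q
  · rw [uIcc_comm] at *
    exact this hφ hN hHN (by rwa [abs_sub_comm]) (not_le.1 hpq).le
  rw [uIcc_of_le hpq] at *
  rcases le_total 0 (φ q - φ p) with h | h
  · exact changesSign_of_phase_lt hfH hH hpq hφ hN hHN (by rwa [abs_of_nonneg h] at hlt)
  · refine changesSign_of_phase_lt (φ := fun x => -φ x) hfH hH hpq hφ.neg hN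
      (fun x hx => by rw [Real.cos_neg, hHN x hx]) ?_
    rw [abs_of_nonpos h] at hlt
    linarith

/-- The `-1` arises because `n` changes need a phase change strictly above `nπ`: if exactly `n`
occur, it is at most `(n + 1)π`. -/
lemma ofReal_phase_le_signChanges {f H N φ : ℝ → ℝ} (hfH : f =ᵐ[volume] H) (hH : Continuous H)
    {t : ℝ} (hφ : ContinuousOn φ [[0, t]]) (hN : ∀ x ∈ [[0, t]], 0 < N x)
    (hHN : ∀ x ∈ [[0, t]], H x = N x * Real.cos (φ x)) :
    ENNReal.ofReal (|φ t - φ 0| / Real.pi - 1) ≤ (signChanges f t : ℝ≥0∞) := by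
  rcases eq_or_ne (signChanges f t) ⊤ with h | h
  · rw [h]; simp
  · obtain ⟨n, hn⟩ := ENat.ne_top_iff_exists.1 h
    rw [← hn]
    simp only [ENat.toENNReal_coe]
    refine ENNReal.ofReal_le_of_le_toReal ?_
    rw [ENNReal.toReal_natCast]
    by_contra! hlt
    have hlt' : Real.pi * (n + 1 : ℕ) < |φ t - φ 0| := by
      have : (n : ℝ) + 1 < |φ t - φ 0| / Real.pi := by linarith
      rw [lt_div_iff₀ Real.pi_pos] at this
      push_cast
      linarith
    have hcs := changesSign_of_phase hfH hH hφ hN hHN hlt'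
    have hle : ((n + 1 : ℕ) : ℕ∞) ≤ signChanges f t :=
      le_iSup (fun m : {n : ℕ // ChangesSign f (Set.uIcc 0 t) n} => ((m : ℕ) : ℕ∞)) ⟨n + 1, hcs⟩
    rw [← hn] at hle
    have : n + 1 ≤ n := by exact_mod_cast hle
    omega

/-- A continuous function has a zero strictly between any two consecutive sign changes. -/
lemma changesSign_le_ncard {f H : ℝ → ℝ} (hfH : f =ᵐ[volume] H) (hH : Continuous H)
    {p q : ℝ} {n : ℕ} (hcs : ChangesSign f (Icc p q) n) (hfin : {x ∈ Ioo p q | H x = 0}.Finite) :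
    n ≤ {x ∈ Ioo p q | H x = 0}.ncard := by
  obtain ⟨ε, hε, x, hx, hxi⟩ := hcs
  -- A separation `2d` keeps the order when each `x i` is moved by less than `d` to a point where
  -- `H` itself has the required sign.
  obtain ⟨d, hd, hsep⟩ : ∃ d : ℝ, 0 < d ∧ ∀ i j : Fin (n + 1), i < j → x i + 2 * d ≤ x j := by
    have hfin' : (univ : Set (Fin (n + 1) × Fin (n + 1))).Finite := finite_univ
    have : ∃ d : ℝ, 0 < d ∧ ∀ ij ∈ (univ : Set (Fin (n + 1) × Fin (n + 1))), ij.1 < ij.2 →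
        x ij.1 + 2 * d ≤ x ij.2 := by
      have hev : ∀ᶠ d : ℝ in 𝓝[>] 0, ∀ ij ∈ (univ : Set (Fin (n + 1) × Fin (n + 1))),
          ij.1 < ij.2 → x ij.1 + 2 * d ≤ x ij.2 := by
        rw [Filter.eventually_all_finite hfin']
        rintro ⟨i, j⟩ -
        by_cases hij : i < j
        · have hlt := hx hij
          have : ∀ᶠ d : ℝ in 𝓝[>] 0, d < (x j - x i) / 2 :=
            eventually_nhdsWithin_of_eventually_nhds (eventually_lt_nhds (by linarith))
          filter_upwards [this] with d hd _
          linarith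
        · exact Eventually.of_forall fun d h => absurd h hij
      obtain ⟨d, h1, h2⟩ := (hev.and self_mem_nhdsWithin).exists
      exact ⟨d, h2, h1⟩
    obtain ⟨d, hd, h⟩ := this
    exact ⟨d, hd, fun i j hij => h (i, j) trivial hij⟩
  have ex : ∀ i : Fin (n + 1), ∃ y ∈ Icc p q, |y - x i| < d ∧ 0 < ε * (-1) ^ (i : ℕ) * H y := by
    intro i
    have hpos := (hxi i).2 d hd
    by_contra! hcon
    refine hpos.ne' (measure_mono_null ?_ (ae_iff.1 hfH))
    rintro y ⟨h1, h2, h3⟩ he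
    rw [he] at h3
    exact (hcon y h1 h2).not_gt h3
  choose y hyI hyd hyH using ex
  have ylt : ∀ i j : Fin (n + 1), i < j → y i < y j := fun i j hij => by
    have h1 := abs_lt.1 (hyd i)
    have h2 := abs_lt.1 (hyd j)
    have h3 := hsep i j hij
    linarith
  have zx : ∀ i : Fin n, ∃ z ∈ Ioo (y i.castSucc) (y i.succ), H z = 0 := by
    intro i
    have h1 := hyH i.castSucc
    have h2 := hyH i.succ
    simp only [Fin.val_castSucc, Fin.val_succ, pow_succ] at h1 h2
    set s := ε * (-1) ^ (i : ℕ) with hs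
    have hcont : ContinuousOn (fun z => -(s * H z)) (Icc (y i.castSucc) (y i.succ)) := by fun_prop
    have hlt := ylt i.castSucc i.succ (Fin.castSucc_lt_succ)
    obtain ⟨z, hz, e⟩ := intermediate_value_Ioo hlt.le hcont
      (⟨by linarith, by linarith⟩ :
        (0 : ℝ) ∈ Ioo (-(s * H (y i.castSucc))) (-(s * H (y i.succ))))
    refine ⟨z, hz, ?_⟩
    have hs0 : s ≠ 0 := fun h0 => by rw [h0, zero_mul] at h1; exact lt_irrefl _ h1
    exact (mul_eq_zero.1 (neg_eq_zero.1 e)).resolve_left hs0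
  choose z hz hz0 using zx
  have zmono : StrictMono z := by
    intro i j hij
    have h1 := (hz i).2
    have h2 := (hz j).1
    have h3 : y i.succ ≤ y j.castSucc := by
      rcases (Fin.succ_le_castSucc_iff.2 hij).eq_or_lt with h | h
      · rw [h]
      · exact (ylt _ _ h).le
    linarith
  have hsub : range z ⊆ {x ∈ Ioo p q | H x = 0} := by
    rintro _ ⟨i, rfl⟩
    exact ⟨⟨(hyI _).1.trans_lt (hz i).1, (hz i).2.trans_le (hyI _).2⟩, hz0 i⟩
  calc n = (range z).ncard := by
        rw [← image_univ, ncard_image_of_injective _ zmono.injective, ncard_univ, Nat.card_fin]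
    _ ≤ _ := ncard_le_ncard hsub hfin

lemma signChanges_le_ncard {f H : ℝ → ℝ} (hfH : f =ᵐ[volume] H) (hH : Continuous H) {t : ℝ}
    {Z : Set ℝ} (hZ : Z.Finite) (hsub : {x ∈ Ioo (min 0 t) (max 0 t) | H x = 0} ⊆ Z) :
    (signChanges f t : ℝ≥0∞) ≤ (Z.ncard : ℝ≥0∞) := by
  have : signChanges f t ≤ (Z.ncard : ℕ∞) := by
    refine iSup_le ?_
    rintro ⟨n, hn⟩
    have := changesSign_le_ncard hfH hH (p := min 0 t) (q := max 0 t) hn (hZ.subset hsub)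
    exact_mod_cast this.trans (ncard_le_ncard hsub hZ)
  calc (signChanges f t : ℝ≥0∞) ≤ ((Z.ncard : ℕ∞) : ℝ≥0∞) := ENat.toENNReal_le.2 this
    _ = _ := by simp

/-- On the real line, twice the real part of `h` is the restriction of the entire function `h z +
conj (h (conj z))`. -/
lemma finite_zeros_re {h : ℂ → ℂ} (hd : Differentiable ℂ h)
    (h0 : ∃ x : ℝ, (h x).re ≠ 0) (r : ℝ) : {x ∈ Icc (-r) r | (h (x : ℝ)).re = 0}.Finite := by
  set k : ℂ → ℂ := fun z => h z + conj (h (conj z)) with hk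
  have hkd : Differentiable ℂ k := hd.add fun z => by
    have := (hd (conj z)).conj_conj
    rwa [Complex.conj_conj] at this
  have hkx : ∀ x : ℝ, k x = (2 * (h x).re : ℝ) := fun x => by
    rw [hk]
    dsimp only
    rw [conj_ofReal, add_conj]
  have hk0 : k ≠ 0 := by
    obtain ⟨x, hx⟩ := h0
    intro hz
    have := hkx x
    rw [hz, Pi.zero_apply] at this
    have h2 : (2 * (h x).re : ℝ) = 0 := by exact_mod_cast this.symm
    exact hx (by linarith)
  have hfin := finite_zeros_of_differentiable hkd hk0 (isCompact_closedBall (0 : ℂ) r)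
  refine (hfin.preimage (f := Complex.ofReal) ofReal_injective.injOn).subset fun x hx => ?_
  refine ⟨by simpa using abs_le.2 hx.1, ?_⟩
  rw [hkx, hx.2]
  simp

/-- Finiteness of the averaged number of sign changes. -/
theorem averagedSignChanges_lt_top {f : ℝ → ℝ} {h : ℂ → ℂ} (hd : Differentiable ℂ h)
    (hfh : f =ᵐ[volume] fun x : ℝ => (h x).re) (h0 : ∃ x : ℝ, (h x).re ≠ 0) (r : ℝ) :
    averagedSignChanges f r < ⊤ := by
  have hH : Continuous fun x : ℝ => (h x).re :=
    Complex.continuous_re.comp (hd.continuous.comp Complex.continuous_ofReal)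
  set Z := {x ∈ Icc (-r) r | (h (x : ℝ)).re = 0} with hZdef
  have hZ : Z.Finite := finite_zeros_re hd h0 r
  -- A zero at the origin itself is harmless, being an endpoint. Without other zeros within `η`, the
  -- integrand vanishes for `t < η`, which removes the singularity of `1 / t`.
  obtain ⟨η, hη, hball⟩ := Metric.isOpen_iff.1 ((hZ.subset (sdiff_subset (t := {0}))).isClosed.isOpen_compl)
    0 (by simp : (0 : ℝ) ∈ (Z \ {0})ᶜ)
  have b1 : ∀ t ∈ Icc (-r) r, (signChanges f t : ℝ≥0∞) ≤ (Z.ncard : ℝ≥0∞) := by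
    intro t ht
    have hr : 0 ≤ r := by linarith [ht.1, ht.2]
    refine signChanges_le_ncard hfh hH hZ fun x hx => ⟨⟨?_, ?_⟩, hx.2⟩
    · exact (le_min (by linarith) ht.1).trans hx.1.1.le
    · exact hx.1.2.le.trans (max_le hr ht.2)
  have b2 : ∀ t ∈ Icc (-r) r, |t| < η → (signChanges f t : ℝ≥0∞) = 0 := by
    intro t ht htη
    have hr : 0 ≤ r := by linarith [ht.1, ht.2]
    have := signChanges_le_ncard (t := t) hfh hH finite_empty fun x hx => by
      have hxt : |x| ≤ |t| ∧ x ≠ 0 := by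
        obtain ⟨⟨h1, h2⟩, -⟩ := hx
        rcases le_total 0 t with h | h
        · rw [min_eq_left h] at h1
          rw [max_eq_right h] at h2
          exact ⟨by rw [abs_of_pos h1, abs_of_nonneg h]; exact h2.le, h1.ne'⟩
        · rw [min_eq_right h] at h1
          rw [max_eq_left h] at h2
          exact ⟨by rw [abs_of_neg h2, abs_of_nonpos h]; linarith, h2.ne⟩
      have hxr : |x| ≤ r := hxt.1.trans (abs_le.2 ht)
      exact hball (by simpa using hxt.1.trans_lt htη : x ∈ Metric.ball (0 : ℝ) η)
        ⟨⟨abs_le.1 hxr, hx.2⟩, hxt.2⟩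
    simpa using this
  have bound : averagedSignChanges f r ≤
      ∫⁻ _ in Ioc (0 : ℝ) r, (2 * (Z.ncard : ℝ≥0∞)) / ENNReal.ofReal η := by
    refine setLIntegral_mono' measurableSet_Ioc fun t ht => ?_
    have m1 : t ∈ Icc (-r) r := ⟨by linarith [ht.1, ht.2], ht.2⟩
    have m2 : -t ∈ Icc (-r) r := ⟨by linarith [ht.2], by linarith [ht.1, ht.2]⟩
    rcases lt_or_ge t η with h | h
    · rw [b2 t m1 (by rwa [abs_of_pos ht.1]), b2 (-t) m2 (by rwa [abs_neg, abs_of_pos ht.1])]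
      simp
    · rw [two_mul]
      exact ENNReal.div_le_div (add_le_add (b1 t m1) (b1 (-t) m2)) (ENNReal.ofReal_le_ofReal h)
  refine bound.trans_lt ?_
  rw [setLIntegral_const]
  refine ENNReal.mul_lt_top (ENNReal.div_lt_top ?_ ?_) ?_
  · exact ENNReal.mul_ne_top (by simp) (by simp)
  · simpa using hη
  · simp

/-! ### Linear growth of the averaged number of sign changes. -/

lemma continuousOn_phase_div {r₀ r : ℝ} (hr₀ : 0 < r₀) {φ : ℝ → ℝ}
    (hφ : ContinuousOn φ (Icc (-r) r)) :
    ContinuousOn (fun t => (φ t - φ (-t)) / t) (Icc r₀ r) :=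
  ((hφ.mono fun t ht => ⟨by linarith [ht.1, ht.2], ht.2⟩).sub
    (hφ.comp continuous_neg.continuousOn fun t ht =>
      ⟨by linarith [ht.2], by linarith [ht.1, ht.2]⟩)).div
    continuousOn_id fun t ht => (hr₀.trans_le ht.1).ne'

lemma integral_phase_log {r₀ r : ℝ} (hr₀ : 0 < r₀) (hr : r₀ ≤ r) {φ : ℝ → ℝ}
    (hφ : ContinuousOn φ (Icc (-r) r)) :
    ∫ s in (Real.log r₀)..(Real.log r), (φ (Real.exp s) - φ (-Real.exp s)) =
      ∫ t in r₀..r, (φ t - φ (-t)) / t := by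
  have hr' : 0 < r := hr₀.trans_le hr
  have himg : Real.exp '' [[Real.log r₀, Real.log r]] ⊆ Icc r₀ r := by
    rintro _ ⟨s, hs, rfl⟩
    rw [uIcc_of_le (Real.log_le_log hr₀ hr)] at hs
    exact ⟨(Real.log_le_iff_le_exp hr₀).1 hs.1, (Real.le_log_iff_exp_le hr').1 hs.2⟩
  have hcont := continuousOn_phase_div hr₀ hφ
  have := intervalIntegral.integral_comp_mul_deriv' (a := Real.log r₀) (b := Real.log r)
    (fun s _ => Real.hasDerivAt_exp s) Real.continuous_exp.continuousOn (hcont.mono himg)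
  rw [Real.exp_log hr₀, Real.exp_log hr'] at this
  rw [← this]
  refine intervalIntegral.integral_congr fun s _ => ?_
  simp only [Function.comp_apply]
  rw [div_mul_cancel₀ _ (Real.exp_pos s).ne']

/-- The logarithm of the pointwise bound is integrated: the sine over `[0, π]` yields `2αr`, and
`|cos| ≤ 1` costs at most `πδr`. -/
lemma arcLog_le {u : ℂ → ℂ} (hd : Differentiable ℂ u) (h0 : u ≠ 0) {C α δ r : ℝ} (hC : 0 < C)
    (hr : 0 < r) (hδ : 0 ≤ δ)
    (hu : ∀ z : ℂ, 0 ≤ z.im → ‖z‖ = r → ‖u z‖ ≤ C * Real.exp (-α * z.im + δ * |z.re|)) :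
    arcLog u r ≤ Real.pi * Real.log C - 2 * α * r + Real.pi * δ * r := by
  have hi : IntervalIntegrable (fun θ => Real.log C - α * r * Real.sin θ + δ * r) volume 0 Real.pi :=
    (by fun_prop : Continuous fun θ => Real.log C - α * r * Real.sin θ + δ * r).intervalIntegrable _ _
  have hle : arcLog u r ≤ ∫ θ in (0 : ℝ)..Real.pi, (Real.log C - α * r * Real.sin θ + δ * r) := by
    refine intervalIntegral.integral_mono_ae_restrict Real.pi_pos.le
      (intervalIntegrable_arcLog hd r zero_mem_Icc_two_pi pi_mem_Icc) hi ?_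
    filter_upwards [ae_restrict_of_ae (ae_circleMap_ne_zero hd h0 hr),
      ae_restrict_mem measurableSet_Icc] with θ h1 hθ
    have him : (circleMap 0 r θ).im = r * Real.sin θ := by
      rw [circleMap_zero, im_ofReal_mul, exp_ofReal_mul_I_im]
    have hre : (circleMap 0 r θ).re = r * Real.cos θ := by
      rw [circleMap_zero, re_ofReal_mul, exp_ofReal_mul_I_re]
    have hsin := Real.sin_nonneg_of_mem_Icc hθ
    have hb := hu (circleMap 0 r θ) (by rw [him]; positivity) (by simp [abs_of_pos hr])
    have := Real.log_le_log (norm_pos_iff.2 h1) hb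
    rw [Real.log_mul hC.ne' (Real.exp_pos _).ne', Real.log_exp, him, hre, abs_mul,
      abs_of_pos hr] at this
    have hcos := mul_le_mul_of_nonneg_left (Real.abs_cos_le_one θ) (by positivity : 0 ≤ δ * r)
    linarith
  refine hle.trans (le_of_eq ?_)
  have hi2 : IntervalIntegrable (fun θ => Real.log C - α * r * Real.sin θ) volume 0 Real.pi :=
    (by fun_prop : Continuous fun θ => Real.log C - α * r * Real.sin θ).intervalIntegrable _ _
  have hi3 : IntervalIntegrable (fun θ => α * r * Real.sin θ) volume 0 Real.pi :=
    (by fun_prop : Continuous fun θ => α * r * Real.sin θ).intervalIntegrable _ _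
  rw [intervalIntegral.integral_add hi2 (by simp), intervalIntegral.integral_sub (by simp) hi3,
    intervalIntegral.integral_const, intervalIntegral.integral_const,
    intervalIntegral.integral_const_mul, integral_sin]
  simp
  ring

lemma le_arcLog {u : ℂ → ℂ} (hd : Differentiable ℂ u) {m ρ : ℝ} (hm : 0 < m) (hρ : 0 < ρ)
    (hu : ∀ z : ℂ, ‖z‖ = ρ → m ≤ ‖u z‖) : Real.pi * Real.log m ≤ arcLog u ρ := by
  have : ∫ _ in (0 : ℝ)..Real.pi, Real.log m ≤ arcLog u ρ := by
    refine intervalIntegral.integral_mono_on Real.pi_pos.le (by simp)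
      (intervalIntegrable_arcLog hd ρ zero_mem_Icc_two_pi pi_mem_Icc) fun θ _ => ?_
    exact Real.log_le_log hm (hu _ (by simp [abs_of_pos hρ]))
  simpa using this

/-- Perturbing an entire function by a small imaginary constant removes its zeros on `[-r, r]`
without changing its real part there. -/
lemma exists_pos_im_perturbation {h : ℂ → ℂ} (hd : Differentiable ℂ h)
    (h0 : ∃ x : ℝ, (h x).re ≠ 0) (r : ℝ) {ε₀ : ℝ} (hε₀ : 0 < ε₀) :
    ∃ ε : ℝ, 0 < ε ∧ ε < ε₀ ∧ ∀ x ∈ Icc (-r) r, h (x : ℝ) + ε * I ≠ 0 := by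
  -- A forbidden `ε` is `-Im h` at one of the finitely many real zeros of the real part.
  have hfin := (finite_zeros_re hd h0 r).image fun x : ℝ => -(h x).im
  obtain ⟨ε, hε, hn⟩ := ((Ioo_infinite hε₀).sdiff hfin).nonempty
  refine ⟨ε, hε.1, hε.2, fun x hx hz => hn ⟨x, ⟨hx, ?_⟩, ?_⟩⟩
  · simpa using congrArg Complex.re hz
  · have := congrArg Complex.im hz
    simp at this
    dsimp only
    linarith

/-- One unit is lost on each side of the origin, so the total loss is the integral of `2 / t` from
`r₀` to `r`. -/
lemma ofReal_le_averagedSignChanges {f H N φ : ℝ → ℝ} (hfH : f =ᵐ[volume] H) (hH : Continuous H)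
    {r₀ r : ℝ} (hr₀ : 0 < r₀) (hr : r₀ ≤ r) (hφ : ContinuousOn φ (Icc (-r) r))
    (hN : ∀ x ∈ Icc (-r) r, 0 < N x) (hHN : ∀ x ∈ Icc (-r) r, H x = N x * Real.cos (φ x)) :
    ENNReal.ofReal ((∫ t in r₀..r, (φ t - φ (-t)) / t) / Real.pi - 2 * Real.log (r / r₀)) ≤
      averagedSignChanges f r := by
  have hr' : 0 < r := hr₀.trans_le hr
  set g : ℝ → ℝ := fun t => ((φ t - φ (-t)) / t) / Real.pi - 2 * t⁻¹ with hg
  have hc1 : ContinuousOn (fun t => (φ t - φ (-t)) / t) [[r₀, r]] := by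
    rw [uIcc_of_le hr]
    exact continuousOn_phase_div hr₀ hφ
  have hc2 : ContinuousOn (fun t : ℝ => t⁻¹) [[r₀, r]] := by
    rw [uIcc_of_le hr]
    exact continuousOn_inv₀.mono fun t ht => (hr₀.trans_le ht.1).ne'
  have e : (∫ t in r₀..r, g t) =
      (∫ t in r₀..r, (φ t - φ (-t)) / t) / Real.pi - 2 * Real.log (r / r₀) := by
    rw [hg, intervalIntegral.integral_sub (hc1.intervalIntegrable.div_const _)
      (hc2.intervalIntegrable.const_mul _), intervalIntegral.integral_div,
      intervalIntegral.integral_const_mul, integral_inv_of_pos hr₀ hr']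
  have gint : IntegrableOn g (Ioc r₀ r) := by
    have : IntervalIntegrable g volume r₀ r :=
      (hc1.intervalIntegrable.div_const _).sub (hc2.intervalIntegrable.const_mul _)
    rwa [intervalIntegrable_iff_integrableOn_Ioc_of_le hr] at this
  rw [← e, intervalIntegral.integral_of_le hr]
  have h1 : ENNReal.ofReal (∫ t in Ioc r₀ r, g t) ≤ ∫⁻ t in Ioc r₀ r, ENNReal.ofReal (g t) := by
    rw [integral_eq_lintegral_pos_part_sub_lintegral_neg_part gint]
    refine (ENNReal.ofReal_le_ofReal (sub_le_self _ ENNReal.toReal_nonneg)).trans ?_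
    exact ENNReal.ofReal_toReal_le
  refine h1.trans ?_
  refine le_trans ?_ (lintegral_mono_set (Ioc_subset_Ioc_left hr₀.le))
  refine setLIntegral_mono' measurableSet_Ioc fun t ht => ?_
  have ht0 : 0 < t := hr₀.trans ht.1
  have sub1 : [[0, t]] ⊆ Icc (-r) r := by
    rw [uIcc_of_le ht0.le]
    exact Icc_subset_Icc (by linarith) ht.2
  have sub2 : [[0, -t]] ⊆ Icc (-r) r := by
    rw [uIcc_of_ge (by linarith)]
    exact Icc_subset_Icc (by linarith [ht.2]) (by linarith)
  have s1 := ofReal_phase_le_signChanges hfH hH (hφ.mono sub1) (fun x hx => hN x (sub1 hx))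
    fun x hx => hHN x (sub1 hx)
  have s2 := ofReal_phase_le_signChanges hfH hH (hφ.mono sub2) (fun x hx => hN x (sub2 hx))
    fun x hx => hHN x (sub2 hx)
  have ge : g t = ((φ t - φ (-t)) / Real.pi - 2) / t := by
    rw [hg]; field_simp
  rw [ge, ENNReal.ofReal_div_of_pos ht0]
  refine ENNReal.div_le_div_right (le_trans ?_ (add_le_add s1 s2)) _
  refine le_trans (ENNReal.ofReal_le_ofReal ?_) ENNReal.ofReal_add_le
  have h3 := le_abs_self (φ t - φ 0)
  have h4 := neg_abs_le (φ (-t) - φ 0)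
  have h5 : (φ t - φ (-t)) / Real.pi ≤ |φ t - φ 0| / Real.pi + |φ (-t) - φ 0| / Real.pi := by
    rw [← add_div]
    exact div_le_div_of_nonneg_right (by linarith) Real.pi_pos.le
  linarith

/-- The averaged number of sign changes of the real part of an entire function that decays like
`exp (-α Im z)` in the upper half-plane grows at least like `2 α r / π`. -/
theorem exists_le_averagedSignChanges {f : ℝ → ℝ} {h : ℂ → ℂ} {α δ C : ℝ}
    (hd : Differentiable ℂ h) (hfh : f =ᵐ[volume] fun x : ℝ => (h x).re)
    (h0 : ∃ x : ℝ, (h x).re ≠ 0) (hα : 0 < α) (hδ : 0 ≤ δ)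
    (hb : ∀ z : ℂ, 0 ≤ z.im → ‖h z‖ ≤ C * Real.exp (-α * z.im + δ * |z.re|)) :
    ∃ K : ℝ, ∀ r : ℝ, 1 ≤ r →
      ENNReal.ofReal ((2 * α / Real.pi - δ) * r - K - 2 * Real.log r) ≤
        averagedSignChanges f r := by
  have hH : Continuous fun x : ℝ => (h x).re :=
    Complex.continuous_re.comp (hd.continuous.comp Complex.continuous_ofReal)
  have hne : h ≠ 0 := by
    obtain ⟨x, hx⟩ := h0
    rintro rfl
    simp at hx
  obtain ⟨D, hD0, hD⟩ : ∃ D : ℝ, 0 < D ∧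
      ∀ z : ℂ, 0 ≤ z.im → ‖h z‖ ≤ D * Real.exp (-α * z.im + δ * |z.re|) := by
    refine ⟨max C 1, by positivity, fun z hz => (hb z hz).trans ?_⟩
    gcongr
    exact le_max_left _ _
  -- A circle free of zeros of `h` gives a positive minimum `m`, needed to bound the inner
  -- half-circle integral from below.
  obtain ⟨r₀, hr₀, hr₀z⟩ : ∃ r₀ ∈ Ioo (0 : ℝ) 1, ∀ z : ℂ, ‖z‖ = r₀ → h z ≠ 0 := by
    have hfin := (finite_zeros_of_differentiable hd hne (isCompact_closedBall (0 : ℂ) 1)).image norm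
    obtain ⟨ρ, hρ, hn⟩ := ((Ioo_infinite (zero_lt_one' ℝ)).sdiff hfin).nonempty
    exact ⟨ρ, hρ, fun z hz h0 => hn ⟨z, ⟨by simpa [hz] using hρ.2.le, h0⟩, hz⟩⟩
  obtain ⟨m, hm, hmz⟩ : ∃ m : ℝ, 0 < m ∧ ∀ z : ℂ, ‖z‖ = r₀ → m ≤ ‖h z‖ := by
    obtain ⟨z₁, hz₁, hmin⟩ := (isCompact_sphere (0 : ℂ) r₀).exists_isMinOn
      (NormedSpace.sphere_nonempty.2 hr₀.1.le) hd.continuous.norm.continuousOn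
    exact ⟨‖h z₁‖, norm_pos_iff.2 (hr₀z z₁ (by simpa using hz₁)),
      fun z hz => hmin (by simpa using hz)⟩
  refine ⟨Real.log (2 * D) - Real.log (m / 2) - 2 * Real.log r₀, fun r hr => ?_⟩
  have hr' : 0 < r := by linarith
  have hrr : r₀ ≤ r := by linarith [hr₀.2]
  -- The perturbation depends on `r`, but with these bounds it at most doubles the upper bound on
  -- `|z| = r` and halves the lower one on `|z| = r₀`, so `K` does not depend on `r`.
  obtain ⟨ε, hε, hεlt, hεne⟩ := exists_pos_im_perturbation hd h0 r
    (lt_min (half_pos hm) (mul_pos hD0 (Real.exp_pos (-α * r))))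
  set u : ℂ → ℂ := fun z => h z + ε * I with hu
  have hud : Differentiable ℂ u := hd.add_const _
  have hεn : ‖(ε * I : ℂ)‖ = ε := by simp [abs_of_pos hε]
  have hpj := phaseJensen_of_real_ne_zero hr₀.1 hrr hud hεne
  obtain ⟨φ, hφ, eφ, iφ⟩ := hpj.phase
  have up := arcLog_le (C := 2 * D) (α := α) (δ := δ) hud hpj.ne_zero (by positivity) hr' hδ
    fun z hz hzr => by
      have h1 : ε ≤ D * Real.exp (-α * z.im + δ * |z.re|) := by
        refine (hεlt.le.trans (min_le_right _ _)).trans ?_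
        gcongr
        have h2 : z.im ≤ r := hzr ▸ Complex.im_le_norm z
        have h3 : 0 ≤ δ * |z.re| := by positivity
        nlinarith
      calc ‖u z‖ ≤ ‖h z‖ + ‖(ε * I : ℂ)‖ := norm_add_le _ _
        _ ≤ D * Real.exp (-α * z.im + δ * |z.re|) + D * Real.exp (-α * z.im + δ * |z.re|) := by
          rw [hεn]; exact add_le_add (hD z hz) h1
        _ = _ := by ring
  have low := le_arcLog (m := m / 2) hud (by positivity) hr₀.1 fun z hz => by
    have h1 := hmz z hz
    have h2 := norm_sub_le_norm_add (h z) (ε * I)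
    rw [hεn] at h2
    have h3 : ε ≤ m / 2 := hεlt.le.trans (min_le_left _ _)
    linarith
  rw [integral_phase_log hr₀.1 hrr hφ] at iφ
  have key := ofReal_le_averagedSignChanges (N := fun x : ℝ => ‖u x‖) hfh hH hr₀.1 hrr hφ
    (fun x hx => norm_pos_iff.2 (hεne x hx)) fun x hx => by
      have := congrArg Complex.re (eφ x hx)
      rw [re_ofReal_mul, exp_ofReal_mul_I_re] at this
      rw [← this, hu]
      simp
  refine le_trans (ENNReal.ofReal_le_ofReal ?_) key
  rw [Real.log_div hr'.ne' hr₀.1.ne']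
  have h1 : (2 * α * r - Real.pi * δ * r - Real.pi * Real.log (2 * D) +
      Real.pi * Real.log (m / 2)) / Real.pi ≤
      (∫ t in r₀..r, (φ t - φ (-t)) / t) / Real.pi :=
    div_le_div_of_nonneg_right (by linarith) Real.pi_pos.le
  have h2 : (2 * α * r - Real.pi * δ * r - Real.pi * Real.log (2 * D) +
      Real.pi * Real.log (m / 2)) / Real.pi =
      (2 * α / Real.pi - δ) * r - Real.log (2 * D) + Real.log (m / 2) := by
    field_simp
  linarith

lemma ofReal_le_liminf_of_linear_lower_bound {S : ℝ → ℝ≥0∞} {c K : ℝ}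
    (h : ∀ r : ℝ, 1 ≤ r → ENNReal.ofReal (c * r - K - 2 * Real.log r) ≤ S r) :
    ENNReal.ofReal c ≤ liminf (fun r => S r / ENNReal.ofReal r) atTop := by
  have h1 : Tendsto (fun r : ℝ => ENNReal.ofReal (c - K * r⁻¹ - 2 * (Real.log r / r))) atTop
      (𝓝 (ENNReal.ofReal c)) := by
    have hl : Tendsto (fun r : ℝ => Real.log r / r) atTop (𝓝 0) := by
      simpa using Real.tendsto_pow_log_div_mul_add_atTop 1 0 1 one_ne_zero
    have := (tendsto_const_nhds (x := c)).sub (tendsto_inv_atTop_zero.const_mul K)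
    have := this.sub (hl.const_mul 2)
    simp only [mul_zero, sub_zero] at this
    exact (ENNReal.continuous_ofReal.tendsto c).comp this
  rw [← h1.liminf_eq]
  refine liminf_le_liminf ?_
  filter_upwards [eventually_ge_atTop (1 : ℝ)] with r hr
  have hr' : 0 < r := by linarith
  have e : c - K * r⁻¹ - 2 * (Real.log r / r) = (c * r - K - 2 * Real.log r) / r := by
    field_simp
  rw [e, ENNReal.ofReal_div_of_pos hr']
  exact ENNReal.div_le_div_right (h r hr) _

end

theorem proposition2 (f : ℝ → ℝ) (a : ℝ) (ha : 0 < a)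
    (hf : CarlemanClass f)
    (hf0 : ¬ f =ᵐ[MeasureTheory.volume] 0)
    (hbdd : HasBoundedSpectrum f)
    (hgap : HasSpectralGap f a) :
    (∀ r : ℝ, 0 < r → averagedSignChanges f r < ⊤) ∧
      ENNReal.ofReal (2 * a / Real.pi) ≤
        Filter.liminf (fun r : ℝ => averagedSignChanges f r / ENNReal.ofReal r) Filter.atTop := by
  -- One parameter controls both losses: decay rate `α = a - η` and horizontal growth `δ = η`.
  have main : ∀ η ∈ Ioo 0 a, (∀ r : ℝ, averagedSignChanges f r < ⊤) ∧
      ENNReal.ofReal (2 * (a - η) / Real.pi - η) ≤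
        liminf (fun r : ℝ => averagedSignChanges f r / ENNReal.ofReal r) atTop := by
    intro η hη
    obtain ⟨h, hd, hfh, C, hC⟩ := exists_entire_of_spectralGap hf hbdd hgap (α := a - η)
      (by linarith [hη.2]) (by linarith [hη.1]) hη.1
    have h0 : ∃ x : ℝ, (h x).re ≠ 0 := by
      by_contra! hz
      exact hf0 (hfh.mono fun x hx => by rw [hx, hz]; rfl)
    obtain ⟨K, hK⟩ := exists_le_averagedSignChanges hd hfh h0 (by linarith [hη.2]) hη.1.le hC
    exact ⟨averagedSignChanges_lt_top hd hfh h0, ofReal_le_liminf_of_linear_lower_bound hK⟩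
  refine ⟨fun r _ => (main (a / 2) ⟨by linarith, by linarith⟩).1 r, ?_⟩
  have lim : Tendsto (fun η : ℝ => ENNReal.ofReal (2 * (a - η) / Real.pi - η)) (𝓝[>] 0)
      (𝓝 (ENNReal.ofReal (2 * a / Real.pi))) := by
    have hc : Continuous fun η : ℝ => ENNReal.ofReal (2 * (a - η) / Real.pi - η) :=
      ENNReal.continuous_ofReal.comp (by fun_prop)
    simpa using (hc.tendsto 0).mono_left nhdsWithin_le_nhds
  refine le_of_tendsto lim ?_
  filter_upwards [Ioo_mem_nhdsGT ha] with η hη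
  exact (main η hη).2
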